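/- Theorem 5.1. Let $(X,*)$ be a finite quandle and let $G$ be an abelian group (written multiplicatively inside the group ring $\mathbf{Z}G$). A positive quandle 2-cocycle is a map $\phi:X\times X\to G$ with $\phi(a,a)=1$ for all $a\in X$ and $$\phi(b,c)^{-2}\,\phi(a,c)\,\phi(a*b,c)\,\phi(a,b)^{-1}\,\phi(a*c,b*c)^{-1}=1\qquad(a,b,c\in X).$$ It is a coboundary if $\phi(a,b)=\varphi(b)^{-2}\varphi(a)\varphi(a*b)$ for some map $\varphi:X\to G$, and $\phi_1,\phi_2$ are cohomologous if $\phi_1\phi_2^{-1}$ is a coboundary. Let $K$ be an oriented knot (or link) diagram in the plane. Colour the regions of $\mathbf{R}^2\setminus K$ black and white in checkerboard fashion, with the unbounded region white. For a crossing $\tau$ put $\epsilon(\tau)=+1$ if the two regions swept out by the over-strand, when it is turned counterclockwise until it meets the under-strand, are black, and $\epsilon(\tau)=-1$ if they are white. A proper coloring $\rho$ of $K$ by $X$ assigns an element of $X$ to each arc such that at each crossing, if the over-arc has colour $b$ and the under-arc to its right has colour $a$, then the under-arc to its left has colour $a*b$; the weight of this crossing is $W_\phi(\tau,\rho)=\phi(a,b)^{\epsilon(\tau)}$.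 Let $Col_X(K)$ be the number of proper colorings, and put $$\Phi_\phi(K)=\sum_\rho\prod_\tau W_\phi(\tau,\rho)\in\mathbf{Z}G,$$ where $\rho$ runs over all proper colorings of $K$ by $X$ and $\tau$ over all crossings of $K$. Then: (1) for every positive quandle 2-cocycle $\phi$, $\Phi_\phi(K)=\Phi_\phi(K')$ whenever the diagrams $K$ and $K'$ are related by planar isotopy and Reidemeister moves; (2) if $\phi_1$ and $\phi_2$ are cohomologous positive quandle 2-cocycles, then $\Phi_{\phi_1}(K)=\Phi_{\phi_2}(K)$ for every diagram $K$; (3) if $\phi$ is a coboundary, then $\Phi_\phi(K)=\sum_{Col_X(K)}1$, the sum of $Col_X(K)$ copies of the unit element, for every diagram $K$. -/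

import Mathlib

/-! ### Oriented link diagrams in the plane

A diagram is recorded as an oriented plane graph: its edges are directed along the orientation,
its vertices are the crossings (four-valent) and finitely many ordinary marked points of the curve
(two-valent vertices, called *joints*, like the corners of a polygonal diagram).  A closed component
without crossings is thus an ordinary cycle of edges. -/

/-- The underlying oriented curve with its crossings. `next e` is the edge that continues `e`
straight on through the vertex at the head of `e`. -/
structure DiagramCurve where
  /-- edges -/
  E : Type
  /-- crossings -/
  C : Type
  [fintypeE : Fintype E]
  [fintypeC : Fintype C]
  next : Equiv.Perm E
  /-- the edge on which the over-strand arrives at a crossing -/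
  overIn : C → E
  /-- the edge on which the under-strand arrives at a crossing -/
  underIn : C → E
  /-- `true` if the under-strand crosses the over-strand from its right to its left (a crossing of
  positive writhe), `false` if from left to right (negative writhe) -/
  pos : C → Bool
  /-- each edge has only one head -/
  incoming_injective : Function.Injective (Sum.elim overIn underIn)

attribute [instance] DiagramCurve.fintypeE DiagramCurve.fintypeC

namespace DiagramCurve

variable (K : DiagramCurve)

/-- The head of `e` is a joint, not a crossing. -/
def IsJoint (e : K.E) : Prop := ∀ c, K.overIn c ≠ e ∧ K.underIn c ≠ e

/-- The edge of the under-strand at `c` that lies to the right of the over-strand. -/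
def underRight (c : K.C) : K.E := bif K.pos c then K.underIn c else K.next (K.underIn c)

/-- The edge of the under-strand at `c` that lies to the left of the over-strand. -/
def underLeft (c : K.C) : K.E := bif K.pos c then K.next (K.underIn c) else K.underIn c

/-- The connected components of the plane graph (the shadow of the diagram). -/
def Piece : Type :=
  Quot fun e f : K.E => f = K.next e ∨ ∃ c, e = K.overIn c ∧ f = K.underIn c

/-- `e` itself for `false`, and the edge after `e` for `true`. -/
def step (e : K.E) (i : Bool) : K.E := bif i then K.next e else e

end DiagramCurve

/-- An oriented link diagram in the plane, up to orientation-preserving homeomorphism of the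
plane: a curve with crossings, together with the regions of its complement, one of them unbounded.
`side e true` is the region to the left of the edge `e`, and `side e false` the one to its right.

The conditions `side_joint`, `side_over_in`, `side_over_out` say which regions meet at a vertex;
`connected` says that any region can be reached from any other by crossing edges; and `planar` is
Euler's formula `V - E + F = 1 + k` for a plane graph with `k` connected components, in which
`V = E - C` since the graph has `C` four-valent and `E - 2C` two-valent vertices. -/
structure LinkDiagram extends DiagramCurve where
  /-- regions -/
  R : Type
  [fintypeR : Fintype R]
  outer : R
  side : E → Bool → R
  side_joint : ∀ e, toDiagramCurve.IsJoint e → side (next e) = side e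
  side_over_in : ∀ c, side (overIn c) true = side (toDiagramCurve.underLeft c) (pos c) ∧
    side (overIn c) false = side (toDiagramCurve.underRight c) (pos c)
  side_over_out : ∀ c, side (next (overIn c)) true = side (toDiagramCurve.underLeft c) (!pos c) ∧
    side (next (overIn c)) false = side (toDiagramCurve.underRight c) (!pos c)
  connected : ∀ r s, Relation.EqvGen (fun r s => ∃ e, r = side e true ∧ s = side e false) r s
  planar : Nat.card R = Nat.card C + Nat.card toDiagramCurve.Piece + 1

attribute [instance] LinkDiagram.fintypeR

namespace LinkDiagram

/-! ### Checkerboard shading -/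

/-- `s` colours the regions black (`true`) and white (`false`) in checkerboard fashion, the
unbounded region being white. -/
def IsShading (D : LinkDiagram) (s : D.R → Bool) : Prop :=
  s D.outer = false ∧ ∀ e, s (D.side e true) ≠ s (D.side e false)

section ShadingExists

variable (D : LinkDiagram)

/-- The mod 2 coboundary from regions to edges. -/
def cobR : (D.R → ZMod 2) →ₗ[ZMod 2] (D.E → ZMod 2) where
  toFun s := fun e => s (D.side e true) + s (D.side e false)
  map_add' s t := by funext e; simp only [Pi.add_apply]; ring
  map_smul' a s := by funext e; simp [mul_add]

/-- A function on the vertices, given by its values at the heads of the edges, has the same value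
at the two edges that end in a crossing. `cross` measures the difference. -/
def cross : (D.E → ZMod 2) →ₗ[ZMod 2] (D.C → ZMod 2) where
  toFun g := fun c => g (D.overIn c) + g (D.underIn c)
  map_add' s t := by funext e; simp only [Pi.add_apply]; ring
  map_smul' a s := by funext e; simp [mul_add]

/-- The mod 2 coboundary from vertices to edges. -/
def cobV : (D.E → ZMod 2) →ₗ[ZMod 2] (D.E → ZMod 2) where
  toFun g := fun e => g e + g (D.next.symm e)
  map_add' s t := by funext e; simp only [Pi.add_apply]; ring
  map_smul' a s := by funext e; simp [mul_add]

theorem zmod2_add_eq_zero {a b : ZMod 2} : a + b = 0 ↔ a = b := by revert a b; decide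

theorem sum_passages {M : Type*} [AddCommMonoid M] (h : D.E → M)
    (hj : ∀ e, D.IsJoint e → h e = 0) :
    ∑ e, h e = ∑ c, (h (D.overIn c) + h (D.underIn c)) := by
  classical
  have h1 : ∑ x : D.C ⊕ D.C, h (Sum.elim D.overIn D.underIn x) = ∑ e, h e := by
    rw [← Finset.sum_image (s := Finset.univ) (g := Sum.elim D.overIn D.underIn)
      (fun x _ y _ hxy => D.incoming_injective hxy)]
    refine Finset.sum_subset (Finset.subset_univ _) fun e _ he => hj e fun c => ⟨?_, ?_⟩
    · rintro rfl; exact he (Finset.mem_image.2 ⟨Sum.inl c, Finset.mem_univ _, rfl⟩)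
    · rintro rfl; exact he (Finset.mem_image.2 ⟨Sum.inr c, Finset.mem_univ _, rfl⟩)
  rw [← h1, Fintype.sum_sum_type, Finset.sum_add_distrib]
  rfl

theorem corner_sum (s : D.R → ZMod 2) (c : D.C) :
    D.cobR s (D.overIn c) + D.cobR s (D.next (D.overIn c)) +
      (D.cobR s (D.underIn c) + D.cobR s (D.next (D.underIn c))) = 0 := by
  have h1 := D.side_over_in c
  have h2 := D.side_over_out c
  simp only [cobR, LinearMap.coe_mk, AddHom.coe_mk, h1.1, h1.2, h2.1, h2.2,
    DiagramCurve.underLeft, DiagramCurve.underRight]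
  cases hp : D.pos c <;> simp <;> generalize s _ = x1 <;> generalize s _ = x2 <;>
    generalize s _ = x3 <;> generalize s _ = x4 <;> revert x1 x2 x3 x4 <;> decide

theorem pairing_zero (s : D.R → ZMod 2) (g : D.E → ZMod 2) (hg : D.cross g = 0) :
    ∑ e, D.cobV g e * D.cobR s e = 0 := by
  have e1 : ∑ e, D.cobV g e * D.cobR s e = ∑ e, g e * (D.cobR s e + D.cobR s (D.next e)) := by
    have : ∑ e, g (D.next.symm e) * D.cobR s e = ∑ e, g e * D.cobR s (D.next e) := by
      rw [← Equiv.sum_comp D.next]; simp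
    simp only [cobV, LinearMap.coe_mk, AddHom.coe_mk, add_mul, mul_add, Finset.sum_add_distrib,
      this]
  rw [e1, sum_passages]
  · refine Finset.sum_eq_zero fun c _ => ?_
    have hc : g (D.overIn c) = g (D.underIn c) := zmod2_add_eq_zero.1 (congrFun hg c)
    rw [hc, ← mul_add, corner_sum, mul_zero]
  · intro e he
    have : D.cobR s (D.next e) = D.cobR s e := by simp [cobR, D.side_joint e he]
    rw [this, CharTwo.add_self_eq_zero, mul_zero]

theorem ker_cobR (s : D.R → ZMod 2) (hs : D.cobR s = 0) (r : D.R) : s r = s D.outer := by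
  have := D.connected r D.outer
  revert this
  generalize D.outer = q
  intro this
  induction this with
  | rel x y h =>
    obtain ⟨e, rfl, rfl⟩ := h
    exact zmod2_add_eq_zero.1 (congrFun hs e)
  | refl x => rfl
  | symm x y _ ih => exact ih.symm
  | trans x y z _ _ ih1 ih2 => exact ih1.trans ih2

open Module in
theorem one_mem_range_cobR : (1 : D.E → ZMod 2) ∈ LinearMap.range D.cobR := by
  classical
  -- first: the image of `cobR` has dimension at least `C + k`
  have hkerR : finrank (ZMod 2) (LinearMap.ker D.cobR) ≤ 1 := by
    have hle : LinearMap.ker D.cobR ≤ Submodule.span (ZMod 2) {(1 : D.R → ZMod 2)} := by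
      intro s hs
      refine Submodule.mem_span_singleton.2 ⟨s D.outer, ?_⟩
      funext r
      simp [D.ker_cobR s hs r]
    exact (Submodule.finrank_mono hle).trans (finrank_span_le_card _ |>.trans (by simp))
  have hrR := LinearMap.finrank_range_add_finrank_ker D.cobR
  rw [finrank_fintype_fun_eq_card, ← Nat.card_eq_fintype_card, D.planar] at hrR
  -- second: the image of the vertex functions has dimension at least `E - C - k`
  have : Finite D.Piece := by unfold DiagramCurve.Piece; infer_instance
  have : Fintype D.Piece := Fintype.ofFinite _
  let N := LinearMap.range (D.cobV.domRestrict (LinearMap.ker D.cross))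
  let P : (D.Piece → ZMod 2) →ₗ[ZMod 2] (D.E → ZMod 2) :=
    LinearMap.funLeft (ZMod 2) (ZMod 2) (fun e => (Quot.mk _ e : D.Piece))
  have hkerV : finrank (ZMod 2) (LinearMap.ker (D.cobV.domRestrict (LinearMap.ker D.cross))) ≤
      Nat.card D.Piece := by
    have hmem : ∀ g : LinearMap.ker (D.cobV.domRestrict (LinearMap.ker D.cross)),
        (g.1.1 : D.E → ZMod 2) ∈ LinearMap.range P := by
      rintro ⟨⟨g, hg⟩, hg'⟩
      have h1 : ∀ e, g (D.next e) = g e := fun e => by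
        have := zmod2_add_eq_zero.1 (congrFun (LinearMap.mem_ker.1 hg') (D.next e))
        simpa using this
      have h2 : ∀ c, g (D.overIn c) = g (D.underIn c) := fun c =>
        zmod2_add_eq_zero.1 (congrFun (LinearMap.mem_ker.1 hg) c)
      refine ⟨fun p : D.Piece => Quot.lift g ?_ p, rfl⟩
      rintro a b (rfl | ⟨c, rfl, rfl⟩)
      · exact (h1 a).symm
      · exact h2 c
    let J := LinearMap.codRestrict (LinearMap.range P)
      ((Submodule.subtype _).comp (Submodule.subtype
        (LinearMap.ker (D.cobV.domRestrict (LinearMap.ker D.cross))))) hmem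
    have hJ : Function.Injective J := by
      intro a b hab
      have := congrArg Subtype.val hab
      exact Subtype.ext (Subtype.ext this)
    calc _ ≤ finrank (ZMod 2) (LinearMap.range P) := LinearMap.finrank_le_finrank_of_injective hJ
      _ ≤ finrank (ZMod 2) (D.Piece → ZMod 2) := LinearMap.finrank_range_le P
      _ = _ := by rw [finrank_fintype_fun_eq_card, Nat.card_eq_fintype_card]
  have hrV := LinearMap.finrank_range_add_finrank_ker
    (D.cobV.domRestrict (LinearMap.ker D.cross))
  have hrC := LinearMap.finrank_range_add_finrank_ker D.cross
  have hleC : finrank (ZMod 2) (LinearMap.range D.cross) ≤ Nat.card D.C := by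
    refine (Submodule.finrank_le _).trans ?_
    rw [finrank_fintype_fun_eq_card, Nat.card_eq_fintype_card]
  rw [finrank_fintype_fun_eq_card] at hrC
  -- third: the two images are orthogonal, so the first is the annihilator of the second
  let N' := N.map (dotProductEquiv (ZMod 2) D.E).toLinearMap
  have hN' : finrank (ZMod 2) N' = finrank (ZMod 2) N :=
    LinearEquiv.finrank_map_eq (dotProductEquiv (ZMod 2) D.E) N
  have hco := Subspace.finrank_add_finrank_dualCoannihilator_eq N'
  rw [finrank_fintype_fun_eq_card] at hco
  have hle : LinearMap.range D.cobR ≤ N'.dualCoannihilator := by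
    rintro _ ⟨s, rfl⟩
    rw [Submodule.mem_dualCoannihilator]
    rintro _ ⟨_, ⟨⟨g, hg⟩, rfl⟩, rfl⟩
    exact D.pairing_zero s g hg
  have heq : LinearMap.range D.cobR = N'.dualCoannihilator := by
    refine Submodule.eq_of_le_of_finrank_le hle ?_
    have : finrank (ZMod 2) N = finrank (ZMod 2)
      (LinearMap.range (D.cobV.domRestrict (LinearMap.ker D.cross))) := rfl
    omega
  rw [heq, Submodule.mem_dualCoannihilator]
  rintro _ ⟨_, ⟨⟨g, hg⟩, rfl⟩, rfl⟩
  have : ∑ e, D.cobV g e = 0 := by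
    simp only [cobV, LinearMap.coe_mk, AddHom.coe_mk, Finset.sum_add_distrib]
    rw [Equiv.sum_comp D.next.symm g, CharTwo.add_self_eq_zero]
  simpa [dotProduct] using this

end ShadingExists

/-- The regions of a plane diagram have exactly one checkerboard shading. -/
theorem existsUnique_isShading (D : LinkDiagram) : ∃! s, D.IsShading s := by
  classical
  obtain ⟨s, hs⟩ := D.one_mem_range_cobR
  have hs' : ∀ e, s (D.side e true) + s (D.side e false) = 1 := congrFun hs
  refine ⟨fun r => decide (s r ≠ s D.outer), ⟨by simp, fun e => ?_⟩, ?_⟩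
  · have := hs' e
    beta_reduce
    revert this
    generalize s (D.side e true) = a
    generalize s (D.side e false) = b
    generalize s D.outer = c
    revert a b c
    decide
  · rintro t ⟨ht, ht'⟩
    let u : D.R → ZMod 2 := fun r => s r + bif t r then 1 else 0
    have hu : D.cobR u = 0 := by
      funext e
      have h1 := hs' e
      have h2 := ht' e
      revert h1 h2
      simp only [cobR, LinearMap.coe_mk, AddHom.coe_mk, u, Pi.zero_apply]
      generalize s (D.side e true) = a
      generalize s (D.side e false) = b
      generalize t (D.side e true) = x
      generalize t (D.side e false) = y
      revert a b x y
      decide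
    funext r
    have := D.ker_cobR u hu r
    revert this
    simp only [u, ht]
    generalize s r = a
    generalize s D.outer = b
    generalize t r = x
    revert a b x
    decide

/-- The checkerboard shading in which the unbounded region is white. -/
noncomputable def shading (D : LinkDiagram) : D.R → Bool := D.existsUnique_isShading.choose

/-- The sign of a crossing: `1` if the two regions that the over-strand sweeps out when it is
turned counterclockwise until it meets the under-strand are black, and `-1` if they are white.
One of these two regions lies to the left of the outgoing over-edge. -/
noncomputable def crossingSign (D : LinkDiagram) (c : D.C) : ℤ :=
  bif D.shading (D.side (D.next (D.overIn c)) true) then 1 else -1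

/-! ### Reidemeister moves -/

/-- The two diagrams differ only in the names of edges, crossings and regions. -/
def Relabel (D D' : LinkDiagram) : Prop :=
  ∃ (ε : D.E ≃ D'.E) (κ : D.C ≃ D'.C) (ρ : D.R ≃ D'.R),
    (∀ e, D'.next (ε e) = ε (D.next e)) ∧
    (∀ c, D'.overIn (κ c) = ε (D.overIn c) ∧ D'.underIn (κ c) = ε (D.underIn c) ∧
      D'.pos (κ c) = D.pos c) ∧
    D'.outer = ρ D.outer ∧
    ∀ e i, D'.side (ε e) i = ρ (D.side e i)

/-- `D'` arises from `D` by marking a new joint on the edge `e₀`: the first half keeps the name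
`e₀`, the second half is the new edge `none`. (Crossings are matched through their outgoing edges, which
keep their names.) -/
def Subdivide (D D' : LinkDiagram) : Prop :=
  ∃ (ε : Option D.E ≃ D'.E) (κ : D.C ≃ D'.C) (ρ : D.R ≃ D'.R) (e₀ : D.E),
    D'.next (ε (some e₀)) = ε none ∧
    D'.next (ε none) = ε (some (D.next e₀)) ∧
    (∀ e, e ≠ e₀ → D'.next (ε (some e)) = ε (some (D.next e))) ∧
    (∀ c, D'.next (D'.overIn (κ c)) = ε (some (D.next (D.overIn c))) ∧
      D'.next (D'.underIn (κ c)) = ε (some (D.next (D.underIn c))) ∧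
      D'.pos (κ c) = D.pos c) ∧
    D'.outer = ρ D.outer ∧
    (∀ e i, D'.side (ε (some e)) i = ρ (D.side e i)) ∧
    ∀ i, D'.side (ε none) i = ρ (D.side e₀ i)

/-- First Reidemeister move: the strand `e`, `next e`, `next (next e)` of `D` gets a kink.  The loop
of the kink is the middle edge, and it encloses a new region (`none`) on its side `p`; the strand
passes the new crossing (`none`) over itself first if `α = false`, and under itself first if
`α = true`. -/
def Move1 (D D' : LinkDiagram) : Prop :=
  ∃ (ε : D.E ≃ D'.E) (κ : Option D.C ≃ D'.C) (ρ : Option D.R ≃ D'.R) (e : D.E) (p α : Bool),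
    (∀ x, D'.next (ε x) = ε (D.next x)) ∧
    (∀ c, D'.overIn (κ (some c)) = ε (D.overIn c) ∧ D'.underIn (κ (some c)) = ε (D.underIn c) ∧
      D'.pos (κ (some c)) = D.pos c) ∧
    D'.overIn (κ none) = ε (D.step e α) ∧
    D'.underIn (κ none) = ε (D.step e (!α)) ∧
    D'.outer = ρ (some D.outer) ∧
    (∀ x i, x ≠ D.next e → D'.side (ε x) i = ρ (some (D.side x i))) ∧
    D'.side (ε (D.next e)) p = ρ none ∧
    D'.side (ε (D.next e)) (!p) = ρ (some (D.side e p))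

/-- Second Reidemeister move: the strand `e`, `next e`, `next (next e)` is pushed over the strand
`f`, `next f`, `next (next f)`, across a region of `D` which lies on side `p` of the first strand
and on side `q` of the second (so the strands run in parallel directions if `p ≠ q`, and in opposite
directions if `p = q`).  Two crossings appear, `inr false` first and then `inr true` along the first
strand, and the two middle edges bound a new bigon (`β r = none`).  Every other region `r` of `D'`
is part of a region `β r` of `D`; the region across which the strand was pushed is cut into the
regions at the two ends of the bigon (which may still be one and the same region), and nothing else
is cut. -/
def Move2 (D D' : LinkDiagram) : Prop :=
  ∃ (ε : D.E ≃ D'.E) (κ : D.C ⊕ Bool ≃ D'.C) (β : D'.R → Option D.R) (bigon : D'.R)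
    (e f : D.E) (p q : Bool),
    (∀ x, D'.next (ε x) = ε (D.next x)) ∧
    (∀ c, D'.overIn (κ (.inl c)) = ε (D.overIn c) ∧ D'.underIn (κ (.inl c)) = ε (D.underIn c) ∧
      D'.pos (κ (.inl c)) = D.pos c) ∧
    (∀ i, D'.overIn (κ (.inr i)) = ε (D.step e i) ∧
      D'.underIn (κ (.inr i)) = ε (D.step f (i ^^ (p == q)))) ∧
    D.side e p = D.side f q ∧
    (∀ r, β r = none ↔ r = bigon) ∧
    (∀ r, ∃ r', β r' = some r) ∧
    (∀ r r', β r = β r' → r = r' ∨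
      (r = D'.side (ε e) p ∧ r' = D'.side (ε (D.next (D.next e))) p) ∨
      (r = D'.side (ε (D.next (D.next e))) p ∧ r' = D'.side (ε e) p)) ∧
    β D'.outer = some D.outer ∧
    (∀ x i, x ≠ D.next e → x ≠ D.next f → β (D'.side (ε x) i) = some (D.side x i)) ∧
    D'.side (ε (D.next e)) (!p) = bigon ∧
    D'.side (ε (D.next f)) (!q) = bigon ∧
    β (D'.side (ε (D.next e)) p) = some (D.side f (!q)) ∧
    β (D'.side (ε (D.next f)) q) = some (D.side e (!p))

/-- Third Reidemeister move: three strands, the top strand `t`, `next t`, `next (next t)`, the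
middle strand `m`, `next m`, `next (next m)` and the bottom strand `b`, `next b`, `next (next b)`,
meet pairwise in the crossings `x` (top over middle), `y` (top over bottom) and `z` (middle over
bottom), and their middle edges bound a triangle `Δ`.  The booleans `i`, `j`, `k` tell which of its
two crossings each strand meets first.  After the move every strand meets its two crossings in the
reverse order, and the new triangle lies on the other sides of the three strands.  All other regions
stay (the sides of the middle edges that face away from the triangle are forced by the
neighbouring edges). -/
def Move3 (D D' : LinkDiagram) : Prop :=
  ∃ (ε : D.E ≃ D'.E) (κ : D.C ≃ D'.C) (ρ : D.R ≃ D'.R) (Δ : D.R) (t m b : D.E) (x y z : D.C)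
    (i j k p q r : Bool),
    (x ≠ y ∧ y ≠ z ∧ x ≠ z) ∧
    (D.overIn x = D.step t i ∧ D.overIn y = D.step t (!i)) ∧
    (D.underIn x = D.step m j ∧ D.overIn z = D.step m (!j)) ∧
    (D.underIn y = D.step b k ∧ D.underIn z = D.step b (!k)) ∧
    (D.side (D.next t) p = Δ ∧ D.side (D.next m) q = Δ ∧ D.side (D.next b) r = Δ) ∧
    (∀ w l, D.side w l = Δ → w = D.next t ∨ w = D.next m ∨ w = D.next b) ∧
    D.outer ≠ Δ ∧
    (∀ w, D'.next (ε w) = ε (D.next w)) ∧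
    (∀ c, c ≠ x → c ≠ y → c ≠ z →
      D'.overIn (κ c) = ε (D.overIn c) ∧ D'.underIn (κ c) = ε (D.underIn c)) ∧
    (∀ c, D'.pos (κ c) = D.pos c) ∧
    (D'.overIn (κ x) = ε (D.step t (!i)) ∧ D'.overIn (κ y) = ε (D.step t i)) ∧
    (D'.underIn (κ x) = ε (D.step m (!j)) ∧ D'.overIn (κ z) = ε (D.step m j)) ∧
    (D'.underIn (κ y) = ε (D.step b (!k)) ∧ D'.underIn (κ z) = ε (D.step b k)) ∧
    D'.outer = ρ D.outer ∧
    (∀ w l, w ≠ D.next t → w ≠ D.next m → w ≠ D.next b →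
      D'.side (ε w) l = ρ (D.side w l)) ∧
    D'.side (ε (D.next t)) (!p) = ρ Δ ∧
    D'.side (ε (D.next m)) (!q) = ρ Δ ∧
    D'.side (ε (D.next b)) (!r) = ρ Δ

/-- Two diagrams are equivalent if they are connected by a finite sequence of Reidemeister moves
(and, as diagrams are considered up to planar isotopy, of renamings and subdivisions), each of which
may be applied in either direction. -/
def ReidemeisterEquiv : LinkDiagram → LinkDiagram → Prop :=
  Relation.EqvGen fun D D' =>
    Relabel D D' ∨ Subdivide D D' ∨ Move1 D D' ∨ Move2 D D' ∨ Move3 D D'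

end LinkDiagram

/-! ### Positive quandle cohomology -/

namespace PosQuandle

variable {X G : Type*}

/-- The quandle operation `a * b`, written as a right action. -/
def op [Quandle X] (a b : X) : X := Shelf.act b a

/-- The `i`-th summand `(a₁, …, aᵢ₋₁, aᵢ₊₁, …, aₙ)` of `d₁` (up to sign). -/
def face₁ {n : ℕ} (a : Fin (n + 1) → X) (i : Fin (n + 1)) : Fin n → X :=
  fun j => a (i.succAbove j)

/-- The `i`-th summand `(a₁ * aᵢ, …, aᵢ₋₁ * aᵢ, aᵢ₊₁, …, aₙ)` of `d₂` (up to sign). -/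
def face₂ [Quandle X] {n : ℕ} (a : Fin (n + 1) → X) (i : Fin (n + 1)) : Fin n → X :=
  fun j => if i.succAbove j < i then op (a (i.succAbove j)) (a i) else a (i.succAbove j)

/-- The quandle cochains: functions on `Xⁿ` (that is, homomorphisms from the free abelian group on
`Xⁿ`) which vanish on the degenerate tuples. -/
def IsCochain [AddCommGroup G] {n : ℕ} (f : (Fin n → X) → G) : Prop :=
  ∀ a, (∃ i j : Fin n, (j : ℕ) = i + 1 ∧ a i = a j) → f a = 0

/-- The positive coboundary `δ₊ f = f ∘ (d₁ + d₂)` of a cochain of degree at least one; counted from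
`0`, the `i`-th term has the sign `(-1) ^ (i + 1)`. -/
def coboundary [Quandle X] [AddCommGroup G] {n : ℕ} (f : (Fin (n + 1) → X) → G) :
    (Fin (n + 2) → X) → G :=
  fun a => ∑ i : Fin (n + 2), (-1 : ℤ) ^ ((i : ℕ) + 1) • (f (face₁ a i) + f (face₂ a i))

/-- `φ` is a positive quandle 2-cocycle of `X` with coefficients in `G`. -/
def IsTwoCocycle [Quandle X] [AddCommGroup G] (φ : (Fin 2 → X) → G) : Prop :=
  IsCochain φ ∧ coboundary φ = 0

/-- `φ` is the positive coboundary of a quandle 1-cochain. -/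
def IsTwoCoboundary [Quandle X] [AddCommGroup G] (φ : (Fin 2 → X) → G) : Prop :=
  ∃ ψ : (Fin 1 → X) → G, IsCochain ψ ∧ φ = coboundary ψ

end PosQuandle

/-! ### The state sum -/

namespace LinkDiagram

open PosQuandle

/-- The proper colourings of `D` by `X`.  A colouring of the arcs is given as a colouring of the
edges which does not change at joints and along over-strands; at a crossing with over-arc `b`, the
under-arcs to the right and to the left of the over-strand have the colours `a` and `a * b`. -/
def Coloring (D : LinkDiagram) (X : Type*) [Quandle X] : Type _ :=
  {ρ : D.E → X // (∀ e, D.IsJoint e → ρ (D.next e) = ρ e) ∧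
    ∀ c, ρ (D.next (D.overIn c)) = ρ (D.overIn c) ∧
      ρ (D.underLeft c) = op (ρ (D.underRight c)) (ρ (D.overIn c))}

noncomputable instance (D : LinkDiagram) (X : Type*) [Quandle X] [Finite X] :
    Fintype (D.Coloring X) :=
  have : Finite (D.Coloring X) := by unfold Coloring; infer_instance
  Fintype.ofFinite _

variable {X G : Type*} [Quandle X] [AddCommGroup G]

/-- The weight `φ(a, b) ^ ε` of a crossing, as an element of the group ring `ℤ[G]` (the group `G`
being written additively). -/
noncomputable def weight (D : LinkDiagram) (φ : (Fin 2 → X) → G) (ρ : D.Coloring X) (c : D.C) :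
    AddMonoidAlgebra ℤ G :=
  AddMonoidAlgebra.single (D.crossingSign c • φ ![ρ.1 (D.underRight c), ρ.1 (D.overIn c)]) 1

/-- The positive quandle 2-cocycle invariant. -/
noncomputable def stateSum [Finite X] (D : LinkDiagram) (φ : (Fin 2 → X) → G) :
    AddMonoidAlgebra ℤ G :=
  ∑ ρ : D.Coloring X, ∏ c : D.C, D.weight φ ρ c

end LinkDiagram

/-! # The state sum of a positive quandle 2-cocycle is a link invariant

Everything rests on one observation about the checkerboard shading. Let `σ e = ±1` record the colour
of the region to the left of the edge `e`. It changes its sign at every passage through a crossing,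
and the sign of a crossing is `σ` of the outgoing over-edge and of the incoming under-edge, and `-σ`
of the two other edges (`crossingSign_eq_overOut` and its companions).

If `φ` is the coboundary of `ψ`, the exponent of a crossing is its sign times
`ψ (underIn) + ψ (underOut) - ψ (overIn) - ψ (overOut)`, that is, the sum over its two passages of
`σ e • ψ e - σ (next e) • ψ (next e)`. The total over all crossings telescopes
(`sum_exponentAt_coboundary`), so that cohomologous cocycles have the same state sum, and that of a
coboundary counts the colourings.

For the invariance, a shading of the diagram after a move is carried back to the diagram before the
move; as shadings are unique, the crossings outside the disc of the move keep their signs. By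
`stateSum_eq_of_local` it then suffices to match the colourings and the exponents inside the disc.

* In the first move the new crossing contributes `φ (a, a) = 0`.
* In the second move, the position of the bigon forces the two new crossings to undo each other on
  colours; the same pair of colours occurs at both, and their shading signs are opposite.
* In the third move the triangle changes its colour, so that the three shading signs
  `(η, -η, η)` become `(-η, η, -η)`. The crossing directions are determined by the position
  of the triangle (`sign_of_corner`), which leaves four cases; in each of them the equality of
  the exponents is the positive cocycle condition (`IsTwoCocycle.triangle`), and the colourings
  match by self-distributivity (`act_triangle`). -/

/-! ### Strands and corners -/

namespace DiagramCurve

variable (K : DiagramCurve)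

@[simp] theorem step_false (e : K.E) : K.step e false = e := rfl

@[simp] theorem step_true (e : K.E) : K.step e true = K.next e := rfl

theorem step_step_not (e : K.E) (i : Bool) : K.step (K.step e i) (!i) = K.next e := by
  cases i <;> rfl

theorem underLeft_eq_step (c : K.C) : K.underLeft c = K.step (K.underIn c) (K.pos c) := by
  unfold underLeft step; cases K.pos c <;> rfl

theorem underRight_eq_step (c : K.C) : K.underRight c = K.step (K.underIn c) (!K.pos c) := by
  unfold underRight step; cases K.pos c <;> rfl

theorem overIn_injective : Function.Injective K.overIn :=
  fun _ _ h => Sum.inl_injective (K.incoming_injective h)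

theorem underIn_injective : Function.Injective K.underIn :=
  fun _ _ h => Sum.inr_injective (K.incoming_injective h)

theorem overIn_ne_underIn (c d : K.C) : K.overIn c ≠ K.underIn d :=
  fun h => Sum.inl_ne_inr (K.incoming_injective (a₁ := .inl c) (a₂ := .inr d) h)

end DiagramCurve

namespace LinkDiagram

open PosQuandle

/-- The four corners at a crossing, as seen from the over-strand: each side of each half of the
over-strand is a side of a half of the under-strand. -/
theorem side_step_overIn (D : LinkDiagram) (c : D.C) (a l : Bool) :
    D.side (D.step (D.overIn c) a) l =
      D.side (D.step (D.underIn c) (!(l ^^ D.pos c))) (a ^^ D.pos c) := by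
  have h1 := D.side_over_in c
  have h2 := D.side_over_out c
  rw [D.underLeft_eq_step, D.underRight_eq_step] at h1 h2
  cases a <;> cases l <;> simp [h1, h2]

/-- The four corners at a crossing, as seen from the under-strand. -/
theorem side_step_underIn (D : LinkDiagram) (c : D.C) (a l : Bool) :
    D.side (D.step (D.underIn c) a) l =
      D.side (D.step (D.overIn c) (l ^^ D.pos c)) (!(a ^^ D.pos c)) := by
  rw [side_step_overIn]
  cases a <;> cases l <;> cases D.pos c <;> rfl

/-! ### Shadings and crossing signs -/

theorem shading_isShading (D : LinkDiagram) : D.IsShading D.shading :=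
  D.existsUnique_isShading.choose_spec.1

theorem IsShading.eq_shading {D : LinkDiagram} {s : D.R → Bool} (h : D.IsShading s) :
    s = D.shading :=
  D.existsUnique_isShading.choose_spec.2 s h

theorem IsShading.side_not {D : LinkDiagram} {s : D.R → Bool} (h : D.IsShading s) (e : D.E)
    (l : Bool) : s (D.side e (!l)) = !s (D.side e l) := by
  have := h.2 e
  cases l
  · exact Bool.eq_not.2 this
  · exact Bool.eq_not.2 this.symm

theorem IsShading.side_next_overIn {D : LinkDiagram} {s : D.R → Bool} (h : D.IsShading s)
    (c : D.C) (l : Bool) :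
    s (D.side (D.next (D.overIn c)) l) = !s (D.side (D.overIn c) l) := by
  have h1 := D.side_step_overIn c false l
  have h2 := D.side_step_overIn c true l
  rw [D.step_true, Bool.true_xor] at h2
  rw [D.step_false, Bool.false_xor] at h1
  rw [h2, h.side_not, h1]

theorem IsShading.side_next_underIn {D : LinkDiagram} {s : D.R → Bool} (h : D.IsShading s)
    (c : D.C) (l : Bool) :
    s (D.side (D.next (D.underIn c)) l) = !s (D.side (D.underIn c) l) := by
  have h1 := D.side_step_underIn c false l
  have h2 := D.side_step_underIn c true l
  rw [D.step_true, Bool.true_xor, Bool.not_not] at h2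
  rw [D.step_false, Bool.false_xor] at h1
  rw [h2, h1, h.side_not, Bool.not_not]

/-- The colour of the region to the left of an edge. -/
noncomputable def leftShade (D : LinkDiagram) (e : D.E) : Bool := D.shading (D.side e true)

theorem leftShade_next_overIn (D : LinkDiagram) (c : D.C) :
    D.leftShade (D.next (D.overIn c)) = !D.leftShade (D.overIn c) :=
  D.shading_isShading.side_next_overIn c true

theorem leftShade_next_underIn (D : LinkDiagram) (c : D.C) :
    D.leftShade (D.next (D.underIn c)) = !D.leftShade (D.underIn c) :=
  D.shading_isShading.side_next_underIn c true

theorem leftShade_overIn (D : LinkDiagram) (c : D.C) :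
    D.leftShade (D.overIn c) = !D.leftShade (D.underIn c) := by
  have h := D.side_step_underIn c false true
  have h0 := D.shading_isShading.side_not (D.overIn c) true
  have h1 := D.leftShade_next_overIn c
  unfold leftShade at *
  revert h
  cases D.pos c
  · intro h
    simp only [Bool.true_xor, Bool.false_xor, Bool.not_false, D.step_true, D.step_false] at h
    rw [h, h1, Bool.not_not]
  · intro h
    simp only [Bool.true_xor, Bool.false_xor, Bool.not_true, D.step_false] at h
    rw [h, ← Bool.not_true, h0, Bool.not_not]

/-- The integer `1` for black and `-1` for white. -/
def shadeSign (b : Bool) : ℤ := bif b then 1 else -1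

theorem shadeSign_not (b : Bool) : shadeSign (!b) = -shadeSign b := by cases b <;> rfl

theorem crossingSign_eq_overOut (D : LinkDiagram) (c : D.C) :
    D.crossingSign c = shadeSign (D.leftShade (D.next (D.overIn c))) := rfl

theorem crossingSign_eq_overIn (D : LinkDiagram) (c : D.C) :
    D.crossingSign c = -shadeSign (D.leftShade (D.overIn c)) := by
  rw [crossingSign_eq_overOut, leftShade_next_overIn, shadeSign_not]

theorem crossingSign_eq_underIn (D : LinkDiagram) (c : D.C) :
    D.crossingSign c = shadeSign (D.leftShade (D.underIn c)) := by
  rw [crossingSign_eq_overIn, leftShade_overIn, shadeSign_not, neg_neg]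

theorem crossingSign_eq_underOut (D : LinkDiagram) (c : D.C) :
    D.crossingSign c = -shadeSign (D.leftShade (D.next (D.underIn c))) := by
  rw [crossingSign_eq_underIn, leftShade_next_underIn, shadeSign_not, neg_neg]

/-! ### The total exponent of a colouring -/

section Exponent

variable {X G : Type*} [Quandle X] [AddCommGroup G]

/-- The colouring rule at the crossing `c`, for an arbitrary colouring of the edges. -/
def ColorsAt (D : LinkDiagram) (ρ : D.E → X) (c : D.C) : Prop :=
  ρ (D.next (D.overIn c)) = ρ (D.overIn c) ∧
    ρ (D.underLeft c) = op (ρ (D.underRight c)) (ρ (D.overIn c))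

/-- The exponent of `G` contributed by the crossing `c`, for an arbitrary colouring of the edges. -/
noncomputable def exponentAt (D : LinkDiagram) (φ : (Fin 2 → X) → G) (ρ : D.E → X) (c : D.C) : G :=
  D.crossingSign c • φ ![ρ (D.underRight c), ρ (D.overIn c)]

theorem prod_weight (D : LinkDiagram) (φ : (Fin 2 → X) → G) (ρ : D.Coloring X) :
    ∏ c, D.weight φ ρ c = AddMonoidAlgebra.single (∑ c, D.exponentAt φ ρ.1 c) 1 := by
  have h : ∀ s : Finset D.C, ∏ c ∈ s, D.weight φ ρ c =
      AddMonoidAlgebra.single (∑ c ∈ s, D.exponentAt φ ρ.1 c) 1 := by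
    classical
    intro s
    induction s using Finset.induction_on with
    | empty => simp [AddMonoidAlgebra.one_def]
    | insert a s ha ih =>
      rw [Finset.prod_insert ha, Finset.sum_insert ha, ih, weight,
        AddMonoidAlgebra.single_mul_single, one_mul]
      rfl
  exact h _

variable [Finite X]

theorem stateSum_eq_sum_single (D : LinkDiagram) (φ : (Fin 2 → X) → G) :
    D.stateSum φ =
      ∑ ρ : D.Coloring X, AddMonoidAlgebra.single (∑ c, D.exponentAt φ ρ.1 c) (1 : ℤ) :=
  Finset.sum_congr rfl fun ρ _ => D.prod_weight φ ρ

/-- Two state sums agree if the colourings correspond to each other under a one-to-one relation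
that preserves the total exponents. -/
theorem stateSum_eq_of_rel {D D' : LinkDiagram} (φ : (Fin 2 → X) → G)
    (r : D.Coloring X → D'.Coloring X → Prop) (ht : Relator.BiTotal r) (hu : Relator.BiUnique r)
    (h : ∀ ρ ρ', r ρ ρ' → ∑ c, D.exponentAt φ ρ.1 c = ∑ c, D'.exponentAt φ ρ'.1 c) :
    D.stateSum φ = D'.stateSum φ := by
  choose f hf using ht.1
  have hbij : Function.Bijective f := by
    refine ⟨fun a b hab => hu.1 (hf a) (hab ▸ hf b), fun b => ?_⟩
    obtain ⟨a, ha⟩ := ht.2 b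
    exact ⟨a, hu.2 (hf a) ha⟩
  rw [stateSum_eq_sum_single, stateSum_eq_sum_single]
  exact Fintype.sum_bijective f hbij _ _ fun ρ => by rw [h ρ (f ρ) (hf ρ)]

end Exponent

/-! ### Coboundaries -/

section Coboundary

variable {X G : Type*} [Quandle X] [AddCommGroup G]

theorem coboundary_one_apply (ψ : (Fin 1 → X) → G) (a b : X) :
    coboundary ψ ![a, b] = ψ ![a] + ψ ![op a b] - (ψ ![b] + ψ ![b]) := by
  have e1 : face₁ ![a, b] 0 = ![b] := by ext j; fin_cases j; rfl
  have e2 : face₂ ![a, b] 0 = ![b] := by ext j; fin_cases j; rfl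
  have e3 : face₁ ![a, b] 1 = ![a] := by ext j; fin_cases j; rfl
  have e4 : face₂ ![a, b] 1 = ![op a b] := by ext j; fin_cases j; rfl
  rw [coboundary, Fin.sum_univ_two, e1, e2, e3, e4]
  simp
  abel

theorem coboundary_two_apply (φ : (Fin 2 → X) → G) (a b c : X) :
    coboundary φ ![a, b, c] = φ ![a, c] + φ ![op a b, c] - (φ ![b, c] + φ ![b, c]) -
      (φ ![a, b] + φ ![op a c, op b c]) := by
  have e1 : face₁ ![a, b, c] 0 = ![b, c] := by ext j; fin_cases j <;> rfl
  have e2 : face₂ ![a, b, c] 0 = ![b, c] := by ext j; fin_cases j <;> rfl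
  have e3 : face₁ ![a, b, c] 1 = ![a, c] := by ext j; fin_cases j <;> rfl
  have e4 : face₂ ![a, b, c] 1 = ![op a b, c] := by ext j; fin_cases j <;> rfl
  have e5 : face₁ ![a, b, c] 2 = ![a, b] := by ext j; fin_cases j <;> rfl
  have e6 : face₂ ![a, b, c] 2 = ![op a c, op b c] := by ext j; fin_cases j <;> rfl
  rw [coboundary, Fin.sum_univ_three, e1, e2, e3, e4, e5, e6]
  simp
  abel

/-- For a coboundary the total exponent is a telescoping sum along the strands: weighted with the
colour to the left of the edge, every edge occurs once at its head and once, with the opposite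
sign, at its tail. -/
theorem sum_exponentAt_coboundary (D : LinkDiagram) (ψ : (Fin 1 → X) → G) (ρ : D.Coloring X) :
    ∑ c, D.exponentAt (coboundary ψ) ρ.1 c = 0 := by
  let g : D.E → G := fun e => shadeSign (D.leftShade e) • ψ ![ρ.1 e]
  have key : ∑ e, (g e - g (D.next e)) = 0 := by
    rw [Finset.sum_sub_distrib, Equiv.sum_comp D.next g, sub_self]
  rw [sum_passages] at key
  · rw [← key]
    refine Finset.sum_congr rfl fun c _ => ?_
    have hc := ρ.2.2 c
    have h1 := D.crossingSign_eq_overOut c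
    have h2 := D.crossingSign_eq_overIn c
    have h3 := D.crossingSign_eq_underIn c
    have h4 := D.crossingSign_eq_underOut c
    have h5 : ψ ![ρ.1 (D.underRight c)] + ψ ![ρ.1 (D.underLeft c)] =
        ψ ![ρ.1 (D.underIn c)] + ψ ![ρ.1 (D.next (D.underIn c))] := by
      unfold DiagramCurve.underLeft DiagramCurve.underRight
      cases D.pos c
      · exact add_comm _ _
      · rfl
    simp only [g, exponentAt, coboundary_one_apply]
    rw [← hc.2, h5, ← h3, ← h1, hc.1, ← neg_eq_iff_eq_neg.2 h2, ← neg_eq_iff_eq_neg.2 h4]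
    module
  · intro e he
    have h1 : D.side (D.next e) = D.side e := D.side_joint e he
    simp only [g, leftShade, h1, ρ.2.1 e he, sub_self]

variable [Finite X]

theorem stateSum_eq_of_sub_coboundary (D : LinkDiagram) {φ₁ φ₂ : (Fin 2 → X) → G}
    (h : IsTwoCoboundary (φ₁ - φ₂)) : D.stateSum φ₁ = D.stateSum φ₂ := by
  obtain ⟨ψ, -, hψ⟩ := h
  rw [stateSum_eq_sum_single, stateSum_eq_sum_single]
  refine Finset.sum_congr rfl fun ρ _ => ?_
  congr 1
  rw [← sub_eq_zero, ← Finset.sum_sub_distrib, ← D.sum_exponentAt_coboundary ψ ρ, ← hψ]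
  exact Finset.sum_congr rfl fun c _ => by simp only [exponentAt, Pi.sub_apply, smul_sub]

theorem stateSum_zero (D : LinkDiagram) :
    D.stateSum (0 : (Fin 2 → X) → G) = ∑ _ρ : D.Coloring X, 1 := by
  rw [stateSum_eq_sum_single]
  simp [exponentAt, AddMonoidAlgebra.one_def]

end Coboundary

/-! ### Changes in a disc -/

section LocalMove

variable {X G : Type*} [Quandle X] [AddCommGroup G]

/-- The colouring rules at the heads of the edges in `P` and at the crossings `c b`. -/
def LocalColoring (D : LinkDiagram) {B : Type} (c : B → D.C) (P : Set D.E) (ρ : D.E → X) : Prop :=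
  (∀ e ∈ P, D.IsJoint e → ρ (D.next e) = ρ e) ∧ ∀ b, D.ColorsAt ρ (c b)

theorem isJoint_iff (D : LinkDiagram) {A B : Type} (κ : A ⊕ B ≃ D.C) (P : Set D.E)
    (hB : ∀ b, D.overIn (κ (.inr b)) ∈ P ∧ D.underIn (κ (.inr b)) ∈ P) {e : D.E} (he : e ∉ P) :
    D.IsJoint e ↔ ∀ a, D.overIn (κ (.inl a)) ≠ e ∧ D.underIn (κ (.inl a)) ≠ e := by
  refine ⟨fun h a => h _, fun h c => ?_⟩
  obtain ⟨x | b, rfl⟩ := κ.surjective c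
  · exact h x
  · exact ⟨fun h => he (h ▸ (hB b).1), fun h => he (h ▸ (hB b).2)⟩

/-- Invariance of the state sum under a change of the diagram in a disc. The edges of the two
diagrams are identified by `ε`, the crossings `A` outside the disc are kept, and the crossings `B`
in the disc are replaced by `B'`; `P` contains the edges which end in the disc, and `S` those which
lie in it. The claim is reduced to the colouring rules and the exponents inside the disc. -/
theorem stateSum_eq_of_local [Finite X] {D D' : LinkDiagram} (φ : (Fin 2 → X) → G)
    (ε : D.E ≃ D'.E) {A B B' : Type} [Fintype A] [Fintype B] [Fintype B']
    (κ : A ⊕ B ≃ D.C) (κ' : A ⊕ B' ≃ D'.C) (P S : Set D.E)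
    (hnext : ∀ e, D'.next (ε e) = ε (D.next e))
    (hkeep : ∀ a, D'.overIn (κ' (.inl a)) = ε (D.overIn (κ (.inl a))) ∧
      D'.underIn (κ' (.inl a)) = ε (D.underIn (κ (.inl a))) ∧
      D'.pos (κ' (.inl a)) = D.pos (κ (.inl a)))
    (hsign : ∀ a, D'.crossingSign (κ' (.inl a)) = D.crossingSign (κ (.inl a)))
    (hB : ∀ b, D.overIn (κ (.inr b)) ∈ P ∧ D.underIn (κ (.inr b)) ∈ P)
    (hB' : ∀ b, ε.symm (D'.overIn (κ' (.inr b))) ∈ P ∧ ε.symm (D'.underIn (κ' (.inr b))) ∈ P)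
    (hA : ∀ a, D.overIn (κ (.inl a)) ∉ P ∧ D.underIn (κ (.inl a)) ∉ P)
    (hS : ∀ e ∉ P, e ∉ S ∧ D.next e ∉ S)
    (hex : ∀ ρ : D.E → X, D.LocalColoring (fun b => κ (.inr b)) P ρ → ∃ ρ' : D.E → X,
      (∀ e ∉ S, ρ' e = ρ e) ∧ D'.LocalColoring (fun b => κ' (.inr b)) (ε '' P) (ρ' ∘ ε.symm))
    (hex' : ∀ ρ' : D.E → X, D'.LocalColoring (fun b => κ' (.inr b)) (ε '' P) (ρ' ∘ ε.symm) →
      ∃ ρ : D.E → X, (∀ e ∉ S, ρ' e = ρ e) ∧ D.LocalColoring (fun b => κ (.inr b)) P ρ)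
    (huniq : ∀ ρ₁ ρ₂ : D.E → X, (∀ e ∉ S, ρ₁ e = ρ₂ e) →
      D.LocalColoring (fun b => κ (.inr b)) P ρ₁ → D.LocalColoring (fun b => κ (.inr b)) P ρ₂ →
      ∀ e ∈ S, ρ₁ e = ρ₂ e)
    (huniq' : ∀ ρ₁ ρ₂ : D.E → X, (∀ e ∉ S, ρ₁ e = ρ₂ e) →
      D'.LocalColoring (fun b => κ' (.inr b)) (ε '' P) (ρ₁ ∘ ε.symm) →
      D'.LocalColoring (fun b => κ' (.inr b)) (ε '' P) (ρ₂ ∘ ε.symm) → ∀ e ∈ S, ρ₁ e = ρ₂ e)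
    (hexp : ∀ ρ ρ' : D.E → X, (∀ e ∉ S, ρ' e = ρ e) →
      D.LocalColoring (fun b => κ (.inr b)) P ρ →
      D'.LocalColoring (fun b => κ' (.inr b)) (ε '' P) (ρ' ∘ ε.symm) →
      ∑ b, D.exponentAt φ ρ (κ (.inr b)) = ∑ b, D'.exponentAt φ (ρ' ∘ ε.symm) (κ' (.inr b))) :
    D.stateSum φ = D'.stateSum φ := by
  have hB'' : ∀ b, D'.overIn (κ' (.inr b)) ∈ ε '' P ∧ D'.underIn (κ' (.inr b)) ∈ ε '' P :=
    fun b => ⟨⟨_, (hB' b).1, ε.apply_symm_apply _⟩, ⟨_, (hB' b).2, ε.apply_symm_apply _⟩⟩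
  have hjoint : ∀ e ∉ P, (D'.IsJoint (ε e) ↔ D.IsJoint e) := fun e he => by
    rw [isJoint_iff D κ P hB he, isJoint_iff D' κ' (ε '' P) hB'' (by simpa using he)]
    simp only [(hkeep _).1, (hkeep _).2.1, ne_eq, ε.apply_eq_iff_eq]
  have hund : ∀ a, D'.underLeft (κ' (.inl a)) = ε (D.underLeft (κ (.inl a))) ∧
      D'.underRight (κ' (.inl a)) = ε (D.underRight (κ (.inl a))) := fun a => by
    simp only [DiagramCurve.underLeft, DiagramCurve.underRight, (hkeep a).2.1, (hkeep a).2.2, hnext]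
    cases D.pos (κ (.inl a)) <;> simp
  have hundS : ∀ a, D.underLeft (κ (.inl a)) ∉ S ∧ D.underRight (κ (.inl a)) ∉ S := fun a => by
    have := hS _ (hA a).2
    unfold DiagramCurve.underLeft DiagramCurve.underRight
    cases D.pos (κ (.inl a))
    · exact this
    · exact this.symm
  -- away from the disc, two colourings that agree off `S` obey the same rules
  have hcol : ∀ ρ ρ' : D.E → X, (∀ e ∉ S, ρ' e = ρ e) → ∀ a,
      (D'.ColorsAt (ρ' ∘ ε.symm) (κ' (.inl a)) ↔ D.ColorsAt ρ (κ (.inl a))) := by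
    intro ρ ρ' h a
    simp only [ColorsAt, hund a, (hkeep a).1, hnext, Function.comp_apply, Equiv.symm_apply_apply,
      h _ (hundS a).1, h _ (hundS a).2, h _ (hS _ (hA a).1).1, h _ (hS _ (hA a).1).2]
  have hexpA : ∀ ρ ρ' : D.E → X, (∀ e ∉ S, ρ' e = ρ e) → ∀ a,
      D.exponentAt φ ρ (κ (.inl a)) = D'.exponentAt φ (ρ' ∘ ε.symm) (κ' (.inl a)) := by
    intro ρ ρ' h a
    simp only [exponentAt, hund a, (hkeep a).1, hsign a, Function.comp_apply,
      Equiv.symm_apply_apply, h _ (hundS a).2, h _ (hS _ (hA a).1).1]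
  have hloc : ∀ ρ : D.Coloring X, D.LocalColoring (fun b => κ (.inr b)) P ρ.1 :=
    fun ρ => ⟨fun e _ => ρ.2.1 e, fun b => ρ.2.2 _⟩
  have hloc' : ∀ ρ' : D'.Coloring X,
      D'.LocalColoring (fun b => κ' (.inr b)) (ε '' P) ((ρ'.1 ∘ ε) ∘ ε.symm) := fun ρ' => by
    rw [Function.comp_assoc, Equiv.self_comp_symm, Function.comp_id]
    exact ⟨fun e _ => ρ'.2.1 e, fun b => ρ'.2.2 _⟩
  refine stateSum_eq_of_rel φ (fun ρ ρ' => ∀ e ∉ S, ρ'.1 (ε e) = ρ.1 e) ⟨?_, ?_⟩ ⟨?_, ?_⟩ ?_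
  · intro ρ
    obtain ⟨ρ', h, hl, hl'⟩ := hex ρ.1 (hloc ρ)
    refine ⟨⟨ρ' ∘ ε.symm, fun e he => ?_, fun c => ?_⟩, fun e he => by simpa using h e he⟩
    · by_cases heP : e ∈ ε '' P
      · exact hl e heP he
      · obtain ⟨e, rfl⟩ := ε.surjective e
        have heP : e ∉ P := by simpa using heP
        simpa [hnext, h _ (hS e heP).1, h _ (hS e heP).2] using ρ.2.1 e ((hjoint e heP).1 he)
    · obtain ⟨a | b, rfl⟩ := κ'.surjective c
      · exact (hcol ρ.1 ρ' h a).2 (ρ.2.2 _)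
      · exact hl' b
  · intro ρ'
    obtain ⟨ρ, h, hl, hl'⟩ := hex' (ρ'.1 ∘ ε) (hloc' ρ')
    refine ⟨⟨ρ, fun e he => ?_, fun c => ?_⟩, fun e he => h e he⟩
    · by_cases heP : e ∈ P
      · exact hl e heP he
      · have := ρ'.2.1 (ε e) ((hjoint e heP).2 he)
        rw [hnext] at this
        exact (h _ (hS e heP).2).symm.trans (this.trans (h _ (hS e heP).1))
    · obtain ⟨a | b, rfl⟩ := κ.surjective c
      · refine (hcol ρ (ρ'.1 ∘ ε) h a).1 ?_
        rw [Function.comp_assoc, Equiv.self_comp_symm, Function.comp_id]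
        exact ρ'.2.2 _
      · exact hl' b
  · intro ρ₁ ρ₂ ρ' h₁ h₂
    have h : ∀ e ∉ S, ρ₁.1 e = ρ₂.1 e := fun e he => (h₁ e he).symm.trans (h₂ e he)
    refine Subtype.ext (funext fun e => ?_)
    by_cases he : e ∈ S
    · exact huniq _ _ h (hloc ρ₁) (hloc ρ₂) e he
    · exact h e he
  · intro ρ ρ₁ ρ₂ h₁ h₂
    have h : ∀ e ∉ S, (ρ₁.1 ∘ ε) e = (ρ₂.1 ∘ ε) e := fun e he => (h₁ e he).trans (h₂ e he).symm
    refine Subtype.ext (funext fun e => ?_)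
    obtain ⟨e, rfl⟩ := ε.surjective e
    by_cases he : e ∈ S
    · exact huniq' _ _ h (hloc' ρ₁) (hloc' ρ₂) e he
    · exact h e he
  · intro ρ ρ' h
    have hs := hexp ρ.1 (ρ'.1 ∘ ε) h (hloc ρ) (hloc' ρ')
    have hA := hexpA ρ.1 (ρ'.1 ∘ ε) h
    rw [Function.comp_assoc, Equiv.self_comp_symm, Function.comp_id] at hs hA
    rw [← Equiv.sum_comp κ, ← Equiv.sum_comp κ', Fintype.sum_sum_type, Fintype.sum_sum_type, hs]
    simp only [hA]

end LocalMove

/-! ### Renamings and subdivisions -/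

section Isotopy

variable {X G : Type*} [Quandle X] [Finite X] [AddCommGroup G]

theorem Relabel.stateSum_eq {D D' : LinkDiagram} (h : Relabel D D') (φ : (Fin 2 → X) → G) :
    D.stateSum φ = D'.stateSum φ := by
  obtain ⟨ε, κ, ρ, hnext, hc, hout, hside⟩ := h
  have hs : D.IsShading (D'.shading ∘ ρ) := by
    refine ⟨?_, fun e => ?_⟩
    · rw [Function.comp_apply, ← hout]; exact D'.shading_isShading.1
    · rw [Function.comp_apply, Function.comp_apply, ← hside, ← hside]
      exact D'.shading_isShading.2 _
  have hS := hs.eq_shading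
  refine stateSum_eq_of_local φ ε (A := D.C) (B := Empty) (B' := Empty) (Equiv.sumEmpty _ _)
    ((Equiv.sumEmpty _ _).trans κ) ∅ ∅ hnext hc (fun a => ?_) (fun b => b.elim) (fun b => b.elim)
    (by simp) (by simp) (fun ρ _ => ⟨ρ, by simp, by simp, fun b => b.elim⟩)
    (fun ρ _ => ⟨ρ, by simp, by simp, fun b => b.elim⟩) (by simp) (by simp) (by simp)
  show D'.crossingSign (κ a) = D.crossingSign a
  rw [crossingSign_eq_overOut, crossingSign_eq_overOut, leftShade, leftShade, (hc a).1, hnext,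
    hside, ← hS]
  rfl

theorem Subdivide.stateSum_eq {D D' : LinkDiagram} (h : Subdivide D D') (φ : (Fin 2 → X) → G) :
    D.stateSum φ = D'.stateSum φ := by
  obtain ⟨ε, κ, ρ, e₀, hn₀, hn₁, hn, hc, hout, hside, hside₁⟩ := h
  have hs : D.IsShading (D'.shading ∘ ρ) := by
    refine ⟨?_, fun e => ?_⟩
    · rw [Function.comp_apply, ← hout]; exact D'.shading_isShading.1
    · rw [Function.comp_apply, Function.comp_apply, ← hside, ← hside]
      exact D'.shading_isShading.2 _
  have hS := hs.eq_shading
  have hsign : ∀ c, D'.crossingSign (κ c) = D.crossingSign c := fun c => by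
    rw [crossingSign_eq_overOut, crossingSign_eq_overOut, leftShade, leftShade, (hc c).1, hside,
      ← hS]
    rfl
  -- the head of the first half of `e₀` is the new joint
  have hj₀ : D'.IsJoint (ε (some e₀)) := by
    intro c
    obtain ⟨c, rfl⟩ := κ.surjective c
    constructor <;> intro h
    · have := (hc c).1; rw [h, hn₀] at this; simp at this
    · have := (hc c).2.1; rw [h, hn₀] at this; simp at this
  -- the last part of an edge of `D` in `D'`
  let last : D.E → D'.E := fun e => D'.next.symm (ε (some (D.next e)))
  have hlast : ∀ e, D'.next (last e) = ε (some (D.next e)) := fun e => D'.next.apply_symm_apply _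
  have hlast₀ : last e₀ = ε none := (Equiv.symm_apply_eq _).2 hn₁.symm
  have hlast' : ∀ e, e ≠ e₀ → last e = ε (some e) := fun e he =>
    (Equiv.symm_apply_eq _).2 (hn e he).symm
  have hover : ∀ c, D'.overIn (κ c) = last (D.overIn c) := fun c =>
    (Equiv.eq_symm_apply _).2 (hc c).1
  have hunder : ∀ c, D'.underIn (κ c) = last (D.underIn c) := fun c =>
    (Equiv.eq_symm_apply _).2 (hc c).2.1
  have hinj : Function.Injective last := fun a b h =>
    D.next.injective (Option.some_injective _ (ε.injective (D'.next.symm.injective h)))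
  have hjoint : ∀ e, D'.IsJoint (last e) ↔ D.IsJoint e := fun e => by
    unfold DiagramCurve.IsJoint
    rw [← κ.forall_congr_right]
    simp only [hover, hunder, ne_eq, hinj.eq_iff]
  -- colourings of the two diagrams that agree on the first halves
  have hcol : ∀ (ρ : D.E → X) (ρ' : D'.E → X), (∀ e, ρ' (ε (some e)) = ρ e) →
      ρ' (ε none) = ρ e₀ →
      (∀ c, ρ' (D'.overIn (κ c)) = ρ (D.overIn c) ∧
        ρ' (D'.next (D'.overIn (κ c))) = ρ (D.next (D.overIn c)) ∧
        ρ' (D'.underLeft (κ c)) = ρ (D.underLeft c) ∧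
        ρ' (D'.underRight (κ c)) = ρ (D.underRight c)) ∧ ∀ e, ρ' (last e) = ρ e := by
    intro ρ ρ' h h₀
    have hl : ∀ e, ρ' (last e) = ρ e := fun e => by
      by_cases he : e = e₀
      · rw [he, hlast₀, h₀]
      · rw [hlast' e he, h]
    refine ⟨fun c => ⟨by rw [hover, hl], by rw [hover, hlast, h], ?_⟩, hl⟩
    unfold DiagramCurve.underLeft DiagramCurve.underRight
    rw [(hc c).2.2, hunder, hlast]
    cases D.pos c <;> simp [h, hl]
  have hnone : ∀ ρ' : D'.Coloring X, ρ'.1 (ε none) = ρ'.1 (ε (some e₀)) := fun ρ' => by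
    rw [← hn₀]; exact ρ'.2.1 _ hj₀
  refine stateSum_eq_of_rel φ (fun ρ ρ' => ∀ e, ρ'.1 (ε (some e)) = ρ.1 e) ⟨?_, ?_⟩ ⟨?_, ?_⟩ ?_
  · intro ρ
    let ρ' : D'.E → X := fun e => ρ.1 ((ε.symm e).getD e₀)
    have h : ∀ e, ρ' (ε (some e)) = ρ.1 e := fun e => by simp [ρ']
    have h₀ : ρ' (ε none) = ρ.1 e₀ := by simp [ρ']
    obtain ⟨h1, h2⟩ := hcol ρ.1 ρ' h h₀
    refine ⟨⟨ρ', fun e he => ?_, fun c => ?_⟩, h⟩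
    · by_cases heq : e = ε (some e₀)
      · rw [heq, hn₀, h, h₀]
      · obtain ⟨x, rfl⟩ : ∃ x, last x = e := by
          obtain ⟨_ | x, rfl⟩ := ε.surjective e
          · exact ⟨e₀, hlast₀⟩
          · exact ⟨x, hlast' x fun hx => heq (hx ▸ rfl)⟩
        rw [hlast, h, h2, ρ.2.1 x ((hjoint x).1 he)]
    · obtain ⟨c, rfl⟩ := κ.surjective c
      rw [(h1 c).1, (h1 c).2.1, (h1 c).2.2.1, (h1 c).2.2.2]
      exact ρ.2.2 c
  · intro ρ'
    obtain ⟨h1, h2⟩ := hcol (fun e => ρ'.1 (ε (some e))) ρ'.1 (fun _ => rfl) (hnone ρ')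
    refine ⟨⟨fun e => ρ'.1 (ε (some e)), fun e he => ?_, fun c => ?_⟩, fun _ => rfl⟩
    · have := ρ'.2.1 _ ((hjoint e).2 he)
      rwa [hlast, h2] at this
    · have := ρ'.2.2 (κ c)
      rwa [(h1 c).1, (h1 c).2.1, (h1 c).2.2.1, (h1 c).2.2.2] at this
  · intro ρ₁ ρ₂ ρ' h₁ h₂
    exact Subtype.ext (funext fun e => (h₁ e).symm.trans (h₂ e))
  · intro ρ ρ₁ ρ₂ h₁ h₂
    refine Subtype.ext (funext fun e => ?_)
    obtain ⟨_ | e, rfl⟩ := ε.surjective e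
    · rw [hnone, hnone, h₁, h₂]
    · rw [h₁, h₂]
  · intro ρ ρ' h
    obtain ⟨h1, -⟩ := hcol ρ.1 ρ'.1 h ((hnone ρ').trans (h e₀))
    rw [← Equiv.sum_comp κ]
    refine Finset.sum_congr rfl fun c _ => ?_
    simp only [exponentAt, hsign, h1]

end Isotopy

end LinkDiagram

/-! ### Acting by an element or by its inverse -/

namespace PosQuandle

section Act

variable {X G : Type*} [Quandle X]

/-- The action of `c` on `a`: `a * c` for `true`, and the unique `x` with `x * c = a` for
`false`. -/
def act (v : Bool) (a c : X) : X := bif v then op a c else Rack.invAct c a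

theorem op_self (a : X) : op a a = a := Quandle.fix

theorem op_left_injective (c : X) : Function.Injective fun a : X => op a c :=
  fun _ _ h => (Rack.left_cancel c).1 h

theorem act_true (a c : X) : act true a c = op a c := rfl

theorem eq_act_false {a b c : X} : b = act false a c ↔ a = op b c := by
  constructor
  · rintro rfl; exact (Rack.right_inv c a).symm
  · rintro rfl; exact (Rack.left_inv c b).symm

theorem act_act_not (v : Bool) (a c : X) : act v (act (!v) a c) c = a := by
  cases v
  · exact Rack.left_inv c a
  · exact Rack.right_inv c a

theorem act_not_act (v : Bool) (a c : X) : act (!v) (act v a c) c = a := by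
  cases v
  · exact Rack.right_inv c a
  · exact Rack.left_inv c a

theorem eq_act_self {v : Bool} {a c : X} : c = act v a c ↔ a = c := by
  cases v
  · rw [eq_act_false, op_self]
  · exact ⟨fun h => op_left_injective c (h.symm.trans (op_self c).symm),
      fun h => by rw [h]; exact (op_self c).symm⟩

theorem act_left_injective {v : Bool} {a b c : X} (h : act v a c = act v b c) : a = b := by
  rw [← act_not_act v a c, h, act_not_act]

theorem eq_act_not {v : Bool} {a b c : X} : b = act (!v) a c ↔ a = act v b c :=
  ⟨fun h => by rw [h, act_act_not], fun h => by rw [h, act_not_act]⟩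

theorem op_op (a b c : X) : op (op a b) c = op (op a c) (op b c) := Shelf.self_distrib

theorem act_op_distrib (w : Bool) (a b c : X) :
    op (act w a b) c = act w (op a c) (op b c) := by
  cases w
  · rw [eq_act_false, ← op_op, ← eq_act_false.1 (rfl : act false a b = _)]
  · exact op_op a b c

theorem act_act_distrib (v w : Bool) (a b c : X) :
    act v (act w a b) c = act w (act v a c) (act v b c) := by
  cases v
  · have h := act_op_distrib w (act false a c) (act false b c) c
    rw [← eq_act_false.1 (rfl : act false a c = _),
      ← eq_act_false.1 (rfl : act false b c = _)] at h
    exact (eq_act_false.2 h.symm).symm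
  · exact act_op_distrib w a b c

/-- Both ways of carrying the colour of the bottom strand around a triple point agree. -/
theorem act_triangle (p w : Bool) (t m b b' : X) :
    act p b t = act (!w) b' (act p m t) ↔ act w b m = act (!p) b' t := by
  rw [eq_act_not, ← act_act_distrib, eq_act_not, eq_comm]

variable [AddCommGroup G]

theorem IsTwoCocycle.apply_self {φ : (Fin 2 → X) → G} (h : IsTwoCocycle φ) (a : X) :
    φ ![a, a] = 0 :=
  h.1 _ ⟨0, 1, rfl, rfl⟩

theorem IsTwoCocycle.add_eq {φ : (Fin 2 → X) → G} (h : IsTwoCocycle φ) (a b c : X) :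
    φ ![a, c] + φ ![op a b, c] - (φ ![b, c] + φ ![b, c]) -
      (φ ![a, b] + φ ![op a c, op b c]) = 0 := by
  rw [← LinkDiagram.coboundary_two_apply, h.2]; rfl

/-- The cocycle condition, in the form in which it occurs for three strands with arbitrary
orientations. -/
theorem IsTwoCocycle.triangle {φ : (Fin 2 → X) → G} (h : IsTwoCocycle φ) (p w : Bool)
    {t m m' b b' B B' : X} (hm : m' = act p m t) (hB : B = act p b t) (hB₂ : B = act (!w) b' m')
    (hB' : B' = act (!p) b' t) (hB₂' : B' = act w b m) :
    φ ![bif p then m else m', t] - φ ![bif p then b else B, t] +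
        φ ![bif !w then b' else B, m'] =
      -(φ ![bif !p then m' else m, t] - φ ![bif !p then b' else B', t] +
        φ ![bif w then b else B', m]) := by
  rw [← sub_eq_zero]
  cases p <;> cases w <;>
    simp only [Bool.not_true, Bool.not_false, eq_act_false, act_true, cond_true, cond_false]
      at hm hB hB₂ hB' hB₂' ⊢
  · have := h.add_eq b' m' t
    rw [← hB', ← hm, ← hB₂] at this
    rw [← neg_eq_zero, ← this]; abel
  · have := h.add_eq B m' t
    rw [← hB, ← hm, ← hB₂] at this
    rw [← neg_eq_zero, ← this]; abel
  · have := h.add_eq B' m t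
    rw [← hB', ← hm, ← hB₂'] at this
    rw [← neg_eq_zero, ← this]; abel
  · have := h.add_eq b m t
    rw [← hB, ← hm, ← hB₂'] at this
    rw [← neg_eq_zero, ← this]; abel

end Act

end PosQuandle

namespace DiagramCurve

/-- The end of the strand `e`, `next e`, `next (next e)` at its first (`false`) or second (`true`)
inner vertex, that is, the outer edge there. -/
def farEnd (K : DiagramCurve) (e : K.E) (i : Bool) : K.E := K.step (K.step e i) i

@[simp] theorem farEnd_false (K : DiagramCurve) (e : K.E) : K.farEnd e false = e := rfl

@[simp] theorem farEnd_true (K : DiagramCurve) (e : K.E) :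
    K.farEnd e true = K.next (K.next e) := rfl

end DiagramCurve

namespace LinkDiagram

open PosQuandle

section Passage

variable {X G : Type*} {D D' : LinkDiagram} {ε : D.E ≃ D'.E}

/-- The exponent at a crossing where the strand from `h` passes over the strand from `g`: the
under-edge to the right is the outer edge of the second strand if `v` is `true`, and the middle edge
otherwise. -/
theorem exponentAt_eq [AddCommGroup G] (φ : (Fin 2 → X) → G)
    (hnext : ∀ e, D'.next (ε e) = ε (D.next e)) {c : D'.C} {h g : D.E} {l k v : Bool}
    (ho : D'.overIn c = ε (D.step h l)) (hu : D'.underIn c = ε (D.step g k))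
    (hp : D'.pos c = (v ^^ k)) {ρ : D.E → X}
    (hρ : ρ (D.next h) = ρ (D.farEnd h l)) :
    D'.exponentAt φ (ρ ∘ ε.symm) c = D'.crossingSign c •
      φ ![bif v then ρ (D.farEnd g k) else ρ (D.next g), ρ (D.next h)] := by
  unfold exponentAt DiagramCurve.underRight
  have h1 : ρ (D.step h l) = ρ (D.next h) := by
    cases l
    · exact hρ.symm
    · rfl
  rw [ho, hu, hp]
  simp only [hnext, Function.comp_apply, Equiv.symm_apply_apply, h1]
  cases k <;> cases v <;>
    simp only [Bool.xor_false, Bool.xor_true, Bool.not_true, Bool.not_false, cond_true, cond_false,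
      DiagramCurve.step_true, DiagramCurve.step_false, DiagramCurve.farEnd_true,
      DiagramCurve.farEnd_false, Equiv.symm_apply_apply]

/-- The colouring rule at a crossing where the strand from `h` passes over the strand from `g`, in
terms of the colours of the middle edges and the outer edges. -/
theorem colorsAt_iff [Quandle X] (hnext : ∀ e, D'.next (ε e) = ε (D.next e)) {c : D'.C} {h g : D.E}
    {l k v : Bool} (ho : D'.overIn c = ε (D.step h l)) (hu : D'.underIn c = ε (D.step g k))
    (hp : D'.pos c = (v ^^ k)) (ρ : D.E → X) :
    D'.ColorsAt (ρ ∘ ε.symm) c ↔ ρ (D.next h) = ρ (D.farEnd h l) ∧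
      ρ (D.next g) = act v (ρ (D.farEnd g k)) (ρ (D.next h)) := by
  unfold ColorsAt DiagramCurve.underLeft DiagramCurve.underRight
  rw [ho, hu, hp]
  simp only [hnext, Function.comp_apply]
  cases l <;> cases k <;> cases v <;>
    simp only [Bool.xor_false, Bool.xor_true, Bool.not_true, Bool.not_false, cond_true, cond_false,
      DiagramCurve.step_true, DiagramCurve.step_false, DiagramCurve.farEnd_true,
      DiagramCurve.farEnd_false, Equiv.symm_apply_apply, eq_act_false, act_true]
  all_goals
    constructor
    · rintro ⟨h1, h2⟩; simp_all
    · rintro ⟨h1, h2⟩; simp_all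

/-- Consecutive over-passages have opposite crossing signs. -/
theorem crossingSign_consecutive_over (D : LinkDiagram) {c d : D.C} {e : D.E} {i : Bool}
    (hc : D.overIn c = D.step e i) (hd : D.overIn d = D.step e (!i)) :
    D.crossingSign d = -D.crossingSign c := by
  cases i
  · rw [crossingSign_eq_overIn, crossingSign_eq_overOut, hc, hd]; rfl
  · rw [crossingSign_eq_overOut, crossingSign_eq_overIn D c, hc, hd, neg_neg]; rfl

/-- Consecutive under-passages have opposite crossing signs. -/
theorem crossingSign_consecutive_under (D : LinkDiagram) {c d : D.C} {e : D.E} {i : Bool}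
    (hc : D.underIn c = D.step e i) (hd : D.underIn d = D.step e (!i)) :
    D.crossingSign d = -D.crossingSign c := by
  cases i
  · rw [crossingSign_eq_underIn, crossingSign_eq_underOut D c, hc, hd, neg_neg]; rfl
  · rw [crossingSign_eq_underOut, crossingSign_eq_underIn D c, hc, hd]; rfl

end Passage

/-! ### The first move -/

section MoveOne

variable {X G : Type*} [Quandle X] [Finite X] [AddCommGroup G]

theorem Move1.stateSum_eq {D D' : LinkDiagram} (h : Move1 D D') {φ : (Fin 2 → X) → G}
    (hφ : IsTwoCocycle φ) : D.stateSum φ = D'.stateSum φ := by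
  obtain ⟨ε, κ, ρ, e, p, α, hnext, hc, hover, hunder, hout, hside, -, -⟩ := h
  have hne : ∀ i c, D.overIn c ≠ D.step e i ∧ D.underIn c ≠ D.step e i := by
    intro i c
    have hκ : κ (some c) ≠ κ none := fun h => Option.some_ne_none c (κ.injective h)
    obtain rfl | rfl := Bool.eq_or_eq_not i α
    · constructor <;> intro h
      · exact hκ (D'.overIn_injective (by rw [(hc c).1, hover, h]))
      · exact D'.overIn_ne_underIn (κ none) (κ (some c)) (by rw [(hc c).2.1, hover, h])
    · constructor <;> intro h
      · exact D'.overIn_ne_underIn (κ (some c)) (κ none) (by rw [(hc c).1, hunder, h])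
      · exact hκ (D'.underIn_injective (by rw [(hc c).2.1, hunder, h]))
  have hj : ∀ i, D.IsJoint (D.step e i) := fun i c => hne i c
  have hloop : e ≠ D.next e := fun h => D'.overIn_ne_underIn (κ none) (κ none) (by
    rw [hover, hunder]
    cases α
    · exact congrArg ε h
    · exact congrArg ε h.symm)
  have hs : D.IsShading (D'.shading ∘ ρ ∘ some) := by
    refine ⟨?_, fun x => ?_⟩
    · rw [Function.comp_apply, Function.comp_apply, ← hout]; exact D'.shading_isShading.1
    · obtain ⟨y, hy, hxy⟩ : ∃ y, y ≠ D.next e ∧ D.side x = D.side y := by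
        by_cases hx : x = D.next e
        · exact ⟨e, hloop, by rw [hx]; exact D.side_joint e (hj false)⟩
        · exact ⟨x, hx, rfl⟩
      simp only [Function.comp_apply, hxy]
      rw [← hside y _ hy, ← hside y _ hy]
      exact D'.shading_isShading.2 _
  have hS := hs.eq_shading
  -- all three edges of the strand have the same colour, before and after the move
  have hrule : ∀ ρ : D.E → X, D'.ColorsAt (ρ ∘ ε.symm) (κ none) ↔
      ρ (D.next e) = ρ e ∧ ρ (D.next (D.next e)) = ρ (D.next e) := by
    intro ρ
    rw [colorsAt_iff hnext hover hunder
      (show D'.pos (κ none) = ((D'.pos (κ none) ^^ !α) ^^ !α) by simp), eq_act_self]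
    cases α
    · exact ⟨fun h => h, fun h => h⟩
    · exact ⟨fun h => ⟨h.2.symm, h.1.symm⟩, fun h => ⟨h.2.symm, h.1.symm⟩⟩
  have hlocD : ∀ (κ₀ : Empty → D.C) (ρ : D.E → X), D.LocalColoring κ₀ {e, D.next e} ρ ↔
      ρ (D.next e) = ρ e ∧ ρ (D.next (D.next e)) = ρ (D.next e) := by
    intro κ₀ ρ
    refine ⟨fun h => ⟨h.1 e (by simp) (hj false), h.1 _ (by simp) (hj true)⟩, fun h => ⟨?_, ?_⟩⟩
    · rintro _ (rfl | rfl) -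
      exacts [h.1, h.2]
    · exact fun b => b.elim
  have hlocD' : ∀ ρ : D.E → X,
      D'.LocalColoring (fun _ : Unit => κ none) (ε '' {e, D.next e}) (ρ ∘ ε.symm) ↔
      ρ (D.next e) = ρ e ∧ ρ (D.next (D.next e)) = ρ (D.next e) := by
    intro ρ
    refine ⟨fun h => (hrule ρ).1 (h.2 ()), fun h => ⟨?_, fun _ => (hrule ρ).2 h⟩⟩
    rintro _ ⟨x, rfl | rfl, rfl⟩ -
    · simpa [hnext] using h.1
    · simpa [hnext] using h.2
  have hmem : ∀ i, D.step e i ∈ ({e, D.next e} : Set D.E) := by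
    intro i; cases i <;> simp
  refine stateSum_eq_of_local φ ε (A := D.C) (B := Empty) (B' := Unit) (Equiv.sumEmpty _ _)
    ((Equiv.optionEquivSumPUnit D.C).symm.trans κ) {e, D.next e} ∅ hnext hc (fun a => ?_)
    (fun b => b.elim) (fun _ => ?_) (fun a => ?_) (by simp)
    (fun ρ h => ⟨ρ, fun _ _ => rfl, (hlocD' ρ).2 ((hlocD _ ρ).1 h)⟩)
    (fun ρ h => ⟨ρ, fun _ _ => rfl, (hlocD _ ρ).2 ((hlocD' ρ).1 h)⟩) (by simp) (by simp) ?_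
  · show D'.crossingSign (κ (some a)) = D.crossingSign a
    rw [crossingSign_eq_overOut, crossingSign_eq_overOut, leftShade, leftShade, (hc a).1, hnext,
      hside _ _ fun h => (hne false a).1 (D.next.injective h), ← hS]
    rfl
  · show ε.symm (D'.overIn (κ none)) ∈ _ ∧ ε.symm (D'.underIn (κ none)) ∈ _
    rw [hover, hunder, ε.symm_apply_apply, ε.symm_apply_apply]
    exact ⟨hmem _, hmem _⟩
  · show D.overIn a ∉ _ ∧ D.underIn a ∉ _
    constructor <;> rintro (h | h)
    exacts [(hne false a).1 h, (hne true a).1 h, (hne false a).2 h, (hne true a).2 h]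
  · intro ρ ρ' h hl hl'
    obtain ⟨h1, h2⟩ := (hlocD' ρ').1 hl'
    have h3 : ρ' (D.next e) = ρ' (D.farEnd e α) := by
      cases α
      exacts [h1, h2.symm]
    have h4 : ρ' (D.farEnd e (!α)) = ρ' (D.next e) := by
      cases α
      exacts [h2, h1.symm]
    rw [Fintype.sum_empty, Fintype.sum_unique]
    show 0 = D'.exponentAt φ (ρ' ∘ ε.symm) (κ none)
    rw [exponentAt_eq φ hnext hover hunder
      (show D'.pos (κ none) = ((D'.pos (κ none) ^^ !α) ^^ !α) by simp) h3, h4, Bool.cond_self,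
      hφ.apply_self, smul_zero]

end MoveOne

/-! ### The second move -/

section MoveTwo

variable {X G : Type*} [Quandle X] [Finite X] [AddCommGroup G]

theorem Move2.stateSum_eq {D D' : LinkDiagram} (h : Move2 D D') (φ : (Fin 2 → X) → G) :
    D.stateSum φ = D'.stateSum φ := by
  classical
  obtain ⟨ε, κ, β, bigon, e, f, p, q, hnext, hc, hnew, -, hβ, hβsurj, hβinj, hβout, hside, hbe, -,
    -, -⟩ := h
  have hover : ∀ i, D'.overIn (κ (.inr i)) = ε (D.step e i) := fun i => (hnew i).1
  have hunder : ∀ i, D'.underIn (κ (.inr i)) = ε (D.step f (i ^^ (p == q))) := fun i => (hnew i).2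
  have hunder' : ∀ k, D'.underIn (κ (.inr (k ^^ (p == q)))) = ε (D.step f k) := fun k => by
    rw [hunder, Bool.xor_assoc, Bool.xor_self, Bool.xor_false]
  -- the four incoming edges are joints of `D`, and they are distinct
  have hne : ∀ i c, (D.overIn c ≠ D.step e i ∧ D.underIn c ≠ D.step e i) ∧
      D.overIn c ≠ D.step f i ∧ D.underIn c ≠ D.step f i := by
    intro i c
    have hκ : ∀ k, κ (.inl c) ≠ κ (.inr k) := fun k h => Sum.inl_ne_inr (κ.injective h)
    refine ⟨⟨fun h => ?_, fun h => ?_⟩, fun h => ?_, fun h => ?_⟩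
    · exact hκ _ (D'.overIn_injective (by rw [(hc c).1, hover i, h]))
    · exact D'.overIn_ne_underIn (κ (.inr i)) (κ (.inl c)) (by rw [(hc c).2.1, hover, h])
    · exact D'.overIn_ne_underIn (κ (.inl c)) (κ (.inr _)) (by rw [(hc c).1, hunder' i, h])
    · exact hκ _ (D'.underIn_injective (by rw [(hc c).2.1, hunder' i, h]))
  have hje : ∀ i, D.IsJoint (D.step e i) := fun i c => (hne i c).1
  have hjf : ∀ i, D.IsJoint (D.step f i) := fun i c => (hne i c).2
  have hef : ∀ i k, D.step e i ≠ D.step f k := fun i k h =>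
    D'.overIn_ne_underIn (κ (.inr i)) (κ (.inr (k ^^ (p == q)))) (by rw [hover, hunder', h])
  have hee : D.next e ≠ e := fun h => by
    have := D'.overIn_injective ((hover true).trans ((congrArg ε h).trans (hover false).symm))
    simpa using κ.injective this
  have hff : D.next f ≠ f := fun h => by
    have := D'.underIn_injective ((hunder' true).trans ((congrArg ε h).trans (hunder' false).symm))
    simpa using κ.injective this
  have hef₀ : e ≠ D.next f := hef false true
  have hef₁ : D.next e ≠ D.next f := hef true true
  have hfar_e : ∀ i, D.farEnd e i ≠ D.next e ∧ D.farEnd e i ≠ D.next f := by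
    rintro (_ | _)
    · exact ⟨hee.symm, hef false true⟩
    · exact ⟨fun h => hee (D.next.injective h), fun h => hef true false (D.next.injective h)⟩
  have hfar_f : ∀ i, D.farEnd f i ≠ D.next e ∧ D.farEnd f i ≠ D.next f := by
    rintro (_ | _)
    · exact ⟨(hef true false).symm, hff.symm⟩
    · exact ⟨fun h => hef false true (D.next.injective h).symm, fun h => hff (D.next.injective h)⟩
  -- the shading of `D'` descends to `D`, since the strand crosses two edges between the two ends
  -- of the bigon
  have hends : D'.shading (D'.side (ε (D.next (D.next e))) p) = D'.shading (D'.side (ε e) p) := by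
    have h1 := D'.shading_isShading.side_next_overIn (κ (.inr false)) p
    have h2 := D'.shading_isShading.side_next_overIn (κ (.inr true)) p
    rw [hover, hnext] at h1 h2
    rw [D.step_false] at h1
    rw [D.step_true] at h2
    rw [h2, h1, Bool.not_not]
  have hwell : ∀ r r', β r = β r' → D'.shading r = D'.shading r' := by
    intro r r' h
    rcases hβinj r r' h with rfl | ⟨rfl, rfl⟩ | ⟨rfl, rfl⟩
    exacts [rfl, hends.symm, hends]
  choose γ hγ using hβsurj
  have hsγ : ∀ r r', β r' = some r → D'.shading (γ r) = D'.shading r' := fun r r' h =>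
    hwell _ _ ((hγ r).trans h.symm)
  have hs : D.IsShading (D'.shading ∘ γ) := by
    refine ⟨(hsγ _ _ hβout).trans D'.shading_isShading.1, fun x => ?_⟩
    obtain ⟨y, hy, hy', hxy⟩ : ∃ y, y ≠ D.next e ∧ y ≠ D.next f ∧ D.side x = D.side y := by
      by_cases hx : x = D.next e
      · exact ⟨e, hee.symm, hef false true, by rw [hx]; exact D.side_joint e (hje false)⟩
      · by_cases hx' : x = D.next f
        · exact ⟨f, (hef true false).symm, hff.symm,
            by rw [hx']; exact D.side_joint f (hjf false)⟩
        · exact ⟨x, hx, hx', rfl⟩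
    simp only [Function.comp_apply, hxy]
    rw [hsγ _ _ (hside y true hy hy'), hsγ _ _ (hside y false hy hy')]
    exact D'.shading_isShading.2 _
  have hS := hs.eq_shading
  -- the bigon lies between the two middle edges, which determines the directions of the crossings
  have hpos : ∀ i, D'.pos (κ (.inr i)) = (!p ^^ (i ^^ (p == q))) := by
    intro i
    have h := D'.side_step_overIn (κ (.inr i)) (!i) (!p)
    have hmid : D'.step (D'.overIn (κ (.inr i))) (!i) = ε (D.next e) := by
      rw [hover]; cases i
      · exact hnext _
      · rfl
    by_contra hcon
    have hfar : D'.step (D'.underIn (κ (.inr i))) (!(!p ^^ D'.pos (κ (.inr i)))) =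
        ε (D.farEnd f (i ^^ (p == q))) := by
      rw [Bool.eq_not.2 hcon, hunder]
      generalize (i ^^ (p == q)) = k
      cases k <;> cases p <;> first | rfl | exact hnext _
    rw [hmid, hbe, hfar] at h
    have h' := hside (D.farEnd f (i ^^ (p == q))) (!i ^^ D'.pos (κ (.inr i)))
      (hfar_f _).1 (hfar_f _).2
    rw [← h, (hβ bigon).2 rfl] at h'
    exact Option.some_ne_none _ h'.symm
  let P : Set D.E := {e, D.next e, f, D.next f}
  have hPe : ∀ i, D.step e i ∈ P := by rintro (_ | _) <;> simp [P]
  have hPf : ∀ i, D.step f i ∈ P := by rintro (_ | _) <;> simp [P]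
  have hP : ∀ x ∈ P, ∃ i, x = D.step e i ∨ x = D.step f i := by
    rintro x (rfl | rfl | rfl | rfl)
    exacts [⟨false, .inl rfl⟩, ⟨true, .inl rfl⟩, ⟨false, .inr rfl⟩, ⟨true, .inr rfl⟩]
  have hlocD : ∀ (κ₀ : Empty → D.C) (ρ : D.E → X), D.LocalColoring κ₀ P ρ ↔
      (ρ (D.next e) = ρ e ∧ ρ (D.next (D.next e)) = ρ (D.next e)) ∧
      ρ (D.next f) = ρ f ∧ ρ (D.next (D.next f)) = ρ (D.next f) := by
    intro κ₀ ρ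
    refine ⟨fun h => ⟨⟨h.1 _ (hPe false) (hje false), h.1 _ (hPe true) (hje true)⟩,
      h.1 _ (hPf false) (hjf false), h.1 _ (hPf true) (hjf true)⟩, fun h => ⟨?_, fun b => b.elim⟩⟩
    rintro _ (rfl | rfl | rfl | rfl) -
    exacts [h.1.1, h.1.2, h.2.1, h.2.2]
  have hlocD' : ∀ ρ : D.E → X,
      D'.LocalColoring (fun i => κ (.inr i)) (ε '' P) (ρ ∘ ε.symm) ↔
      (ρ (D.next e) = ρ e ∧ ρ (D.next (D.next e)) = ρ (D.next e)) ∧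
      ρ (D.next f) = act (!p) (ρ f) (ρ (D.next e)) ∧
      ρ (D.next f) = act (!p) (ρ (D.next (D.next f))) (ρ (D.next e)) := by
    intro ρ
    have hrule := fun i => colorsAt_iff hnext (hover i) (hunder i) (hpos i) ρ
    have h1 : D'.LocalColoring (fun i => κ (.inr i)) (ε '' P) (ρ ∘ ε.symm) ↔
        ∀ i, D'.ColorsAt (ρ ∘ ε.symm) (κ (.inr i)) := by
      refine ⟨fun h => h.2, fun h => ⟨?_, h⟩⟩
      rintro _ ⟨x, hx, rfl⟩ hj
      obtain ⟨i, rfl | rfl⟩ := hP x hx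
      · exact absurd (hover i) (hj _).1
      · exact absurd (hunder' i) (hj _).2
    rw [h1, Bool.forall_bool, hrule, hrule]
    generalize (p == q) = u
    cases u <;>
      simp only [Bool.xor_false, Bool.xor_true, Bool.not_true, Bool.not_false,
        DiagramCurve.farEnd_true, DiagramCurve.farEnd_false] <;>
      constructor
    · exact fun h => ⟨⟨h.1.1, h.2.1.symm⟩, h.1.2, h.2.2⟩
    · exact fun h => ⟨⟨h.1.1, h.2.1⟩, h.1.2.symm, h.2.2⟩
    · exact fun h => ⟨⟨h.1.1, h.2.1.symm⟩, h.2.2, h.1.2⟩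
    · exact fun h => ⟨⟨h.1.1, h.2.2⟩, h.1.2.symm, h.2.1⟩
  -- only the middle edge of the lower strand is recoloured
  refine stateSum_eq_of_local φ ε (A := D.C) (B := Empty) (B' := Bool) (Equiv.sumEmpty _ _) κ P
    {D.next f} hnext hc (fun a => ?_) (fun b => b.elim) (fun i => ?_) (fun a => ?_) (fun x hx => ?_)
    (fun ρ hl => ?_) (fun ρ' hl => ?_) (fun ρ₁ ρ₂ h h₁ h₂ => ?_) (fun ρ₁ ρ₂ h h₁ h₂ => ?_)
    (fun ρ ρ' h hl hl' => ?_)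
  · show D'.crossingSign (κ (.inl a)) = D.crossingSign a
    rw [crossingSign_eq_overOut, crossingSign_eq_overOut, leftShade, leftShade, (hc a).1, hnext,
      ← hS, Function.comp_apply, hsγ _ _ (hside _ _ (fun h => (hne false a).1.1 (D.next.injective h))
        (fun h => (hne false a).2.1 (D.next.injective h)))]
  · rw [hover, hunder, ε.symm_apply_apply, ε.symm_apply_apply]
    exact ⟨hPe _, hPf _⟩
  · show D.overIn a ∉ P ∧ D.underIn a ∉ P
    constructor <;> intro h <;> obtain ⟨i, h | h⟩ := hP _ h
    exacts [(hne i a).1.1 h, (hne i a).2.1 h, (hne i a).1.2 h, (hne i a).2.2 h]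
  · exact ⟨fun h => hx (h ▸ hPf true), fun h => hx (D.next.injective h ▸ hPf false)⟩
  · obtain ⟨he, hf⟩ := (hlocD _ ρ).1 hl
    have hu : ∀ v, ∀ x ≠ D.next f, Function.update ρ (D.next f) v x = ρ x := fun v x hx =>
      Function.update_of_ne hx v ρ
    refine ⟨Function.update ρ (D.next f) (act (!p) (ρ f) (ρ (D.next e))), hu _, (hlocD' _).2 ?_⟩
    rw [Function.update_self, hu _ _ hef₁, hu _ _ hef₀, hu _ (D.next (D.next e)) (hfar_e true).2,
      hu _ _ hff.symm, hu _ (D.next (D.next f)) (hfar_f true).2, hf.2, hf.1]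
    exact ⟨he, rfl, rfl⟩
  · obtain ⟨he, hf⟩ := (hlocD' ρ').1 hl
    have hu : ∀ v, ∀ x ≠ D.next f, Function.update ρ' (D.next f) v x = ρ' x := fun v x hx =>
      Function.update_of_ne hx v ρ'
    refine ⟨Function.update ρ' (D.next f) (ρ' f), fun x hx => (hu _ x hx).symm, (hlocD _ _).2 ?_⟩
    rw [Function.update_self, hu _ _ hef₁, hu _ _ hef₀, hu _ (D.next (D.next e)) (hfar_e true).2,
      hu _ _ hff.symm, hu _ (D.next (D.next f)) (hfar_f true).2]
    exact ⟨he, rfl, act_left_injective (hf.2.symm.trans hf.1)⟩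
  · rintro x rfl
    rw [((hlocD _ ρ₁).1 h₁).2.1, ((hlocD _ ρ₂).1 h₂).2.1, h _ hff.symm]
  · rintro x rfl
    rw [((hlocD' ρ₁).1 h₁).2.1, ((hlocD' ρ₂).1 h₂).2.1, h _ hff.symm, h _ hef₁]
  · obtain ⟨he, hf⟩ := (hlocD' ρ').1 hl'
    have hfar : ∀ k, ρ' (D.farEnd f k) = ρ' f := by
      rintro (_ | _)
      · rfl
      · exact act_left_injective (hf.2.symm.trans hf.1)
    have hsgn : D'.crossingSign (κ (.inr true)) = -D'.crossingSign (κ (.inr false)) := by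
      rw [crossingSign_eq_overIn, crossingSign_eq_overOut, hover, hover, hnext]
      rfl
    rw [Fintype.sum_empty, Fintype.sum_bool,
      exponentAt_eq φ hnext (hover true) (hunder true) (hpos true) he.2.symm,
      exponentAt_eq φ hnext (hover false) (hunder false) (hpos false) he.1, hfar, hfar, hsgn,
      neg_smul, neg_add_cancel]

end MoveTwo

/-! ### The third move -/

section MoveThree

/-- Let the strands from `h` and `g` meet in a crossing (`π` is `pos` of the crossing if
the first strand passes over, and its negation if it passes under), and let the region `Δ`
lie between their middle edges. Then `π` is determined by the side of the first strand on which `Δ`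
lies and by the place of the crossing on the second strand. -/
theorem sign_of_corner (D : LinkDiagram) {h g : D.E} {l k π p : Bool} {Δ : D.R}
    (hcorner : ∀ a b, D.side (D.step (D.step h l) a) b =
      D.side (D.step (D.step g k) (!(b ^^ π))) (a ^^ π))
    (hΔ : D.side (D.next h) p = Δ) (hfar : ∀ b, D.side (D.farEnd g k) b ≠ Δ) : π = (p ^^ k) := by
  have h1 := hcorner (!l) p
  rw [D.step_step_not, hΔ] at h1
  by_contra hcon
  have hk : (!(p ^^ π)) = k := by
    rw [Bool.eq_not.2 hcon]; cases p <;> cases k <;> rfl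
  rw [hk] at h1
  exact hfar _ h1.symm

/-- In the situation of `sign_of_corner`, let `f` be a shading of the sides of the edges after the
move and `u` a shading of the regions. If they agree on the outer edges, and if the outer and the
middle edge of the first strand are on both sides of a crossing after the move, then they agree on
the side of the middle edge which faces away from `Δ`. -/
theorem shade_away_from_triangle (D : LinkDiagram) {h g : D.E} {l k π p : Bool} {Δ : D.R}
    (hcorner : ∀ a b, D.side (D.step (D.step h l) a) b =
      D.side (D.step (D.step g k) (!(b ^^ π))) (a ^^ π))
    (hΔ : D.side (D.next h) p = Δ) (hfar : ∀ b, D.side (D.farEnd g k) b ≠ Δ)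
    (u : D.R → Bool) (f : D.E → Bool → Bool) (hf : ∀ e b, f e (!b) = !f e b)
    (hfu : ∀ b, f (D.farEnd g k) b = u (D.side (D.farEnd g k) b))
    (hfu' : ∀ b, f (D.farEnd h l) b = u (D.side (D.farEnd h l) b))
    (hflip : ∀ b, f (D.next (D.step h l)) b = !f (D.step h l) b) :
    u (D.side (D.next h) (!p)) = f (D.next h) (!p) := by
  have hk : (!(!p ^^ π)) = k := by
    rw [D.sign_of_corner hcorner hΔ hfar]; cases p <;> cases k <;> rfl
  have h1 := hcorner (!l) (!p)
  have h2 := hcorner l (!p)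
  have h3 : f (D.next h) (!p) = !f (D.farEnd h l) (!p) := by
    have := hflip (!p)
    cases l
    · exact this
    · rw [D.farEnd_true, ← D.step_true h, this, Bool.not_not]
  rw [hk] at h1 h2
  rw [D.step_step_not] at h1
  change D.side (D.farEnd h l) (!p) = D.side (D.farEnd g k) (l ^^ π) at h2
  change _ = D.side (D.farEnd g k) _ at h1
  rw [h1, h3, hfu', h2, ← hfu, ← hfu, Bool.not_xor, hf]

theorem not_isJoint_of_incoming {D : LinkDiagram} {e : D.E} {c : D.C}
    (h : D.overIn c = e ∨ D.underIn c = e) : ¬ D.IsJoint e := fun hj =>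
  h.elim (hj c).1 (hj c).2

/-- The parity computation for a triangle: the directions of the crossings of the top with the
middle strand and of the middle with the bottom strand both depend on the side `q` of the middle
strand; eliminating it expresses the latter through the side `p` of the top strand. -/
theorem triangle_sign_bits (p q i j k : Bool) (h : (!(p ^^ j)) = (q ^^ i)) :
    (q ^^ !k) = (!(p ^^ i ^^ j) ^^ !k) := by
  revert p q i j k; decide

variable {X G : Type*} [Quandle X] [Finite X] [AddCommGroup G]

theorem Move3.stateSum_eq {D D' : LinkDiagram} (h : Move3 D D') {φ : (Fin 2 → X) → G}
    (hφ : IsTwoCocycle φ) : D.stateSum φ = D'.stateSum φ := by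
  classical
  obtain ⟨ε, κ, σ, Δ, t, m, b, x, y, z, i, j, k, p, q, r, ⟨hxy, hyz, hxz⟩, ⟨hxo, hyo⟩, ⟨hxu, hzo⟩,
    ⟨hyu, hzu⟩, ⟨hΔt, hΔm, hΔb⟩, hΔ, hout, hnext, hkeep, hpos, ⟨hxo', hyo'⟩, ⟨hxu', hzo'⟩,
    ⟨hyu', hzu'⟩, hout', hside, hΔt', hΔm', hΔb'⟩ := h
  -- the six incoming edges are distinct
  have htt : t ≠ D.next t := by
    have : D.step t i ≠ D.step t (!i) := by
      rw [← hxo, ← hyo]; exact fun h => hxy (D.overIn_injective h)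
    cases i
    exacts [this, this.symm]
  have hmm : m ≠ D.next m := by
    have : D.step m j ≠ D.step m (!j) := by
      rw [← hxu, ← hzo]; exact (D.overIn_ne_underIn _ _).symm
    cases j
    exacts [this, this.symm]
  have hbb : b ≠ D.next b := by
    have : D.step b k ≠ D.step b (!k) := by
      rw [← hyu, ← hzu]; exact fun h => hyz (D.underIn_injective h)
    cases k
    exacts [this, this.symm]
  have htm : ∀ a c, D.step t a ≠ D.step m c := by
    intro a c
    obtain rfl | rfl := Bool.eq_or_eq_not a i <;> obtain rfl | rfl := Bool.eq_or_eq_not c j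
    · rw [← hxo, ← hxu]; exact D.overIn_ne_underIn _ _
    · rw [← hxo, ← hzo]; exact fun h => hxz (D.overIn_injective h)
    · rw [← hyo, ← hxu]; exact D.overIn_ne_underIn _ _
    · rw [← hyo, ← hzo]; exact fun h => hyz (D.overIn_injective h)
  have htb : ∀ a c, D.step t a ≠ D.step b c := by
    intro a c
    obtain rfl | rfl := Bool.eq_or_eq_not a i <;> obtain rfl | rfl := Bool.eq_or_eq_not c k
    · rw [← hxo, ← hyu]; exact D.overIn_ne_underIn _ _
    · rw [← hxo, ← hzu]; exact D.overIn_ne_underIn _ _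
    · rw [← hyo, ← hyu]; exact D.overIn_ne_underIn _ _
    · rw [← hyo, ← hzu]; exact D.overIn_ne_underIn _ _
  have hmb : ∀ a c, D.step m a ≠ D.step b c := by
    intro a c
    obtain rfl | rfl := Bool.eq_or_eq_not a j <;> obtain rfl | rfl := Bool.eq_or_eq_not c k
    · rw [← hxu, ← hyu]; exact fun h => hxy (D.underIn_injective h)
    · rw [← hxu, ← hzu]; exact fun h => hxz (D.underIn_injective h)
    · rw [← hzo, ← hyu]; exact D.overIn_ne_underIn _ _
    · rw [← hzo, ← hzu]; exact D.overIn_ne_underIn _ _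
  let M : Set D.E := {D.next t, D.next m, D.next b}
  have hstart : t ∉ M ∧ m ∉ M ∧ b ∉ M := by
    refine ⟨?_, ?_, ?_⟩ <;> rintro (h | h | h)
    exacts [htt h, htm false true h, htb false true h, htm true false h.symm, hmm h,
      hmb false true h, htb true false h.symm, hmb true false h.symm, hbb h]
  have hnextM : ∀ e ∈ M, D.next e ∉ M := by
    have hinj := D.next.injective
    rintro _ (rfl | rfl | rfl) (h | h | h)
    exacts [htt (hinj h).symm, htm true false (hinj h), htb true false (hinj h),
      htm false true (hinj h).symm, hmm (hinj h).symm, hmb true false (hinj h),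
      htb false true (hinj h).symm, hmb false true (hinj h).symm, hbb (hinj h).symm]
  have hfart : ∀ a, D.farEnd t a ∉ M := by
    rintro (_ | _); exacts [hstart.1, hnextM _ (.inl rfl)]
  have hfarm : ∀ a, D.farEnd m a ∉ M := by
    rintro (_ | _); exacts [hstart.2.1, hnextM _ (.inr (.inl rfl))]
  have hfarb : ∀ a, D.farEnd b a ∉ M := by
    rintro (_ | _); exacts [hstart.2.2, hnextM _ (.inr (.inr rfl))]
  have hΔM : ∀ e ∉ M, ∀ l, D.side e l ≠ Δ := fun e he l h => he (hΔ e l h)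
  -- the corners of the triangle, and the signs of the crossings
  have cx := D.side_step_overIn x
  have cx' : ∀ a l, D.side (D.step (D.underIn x) a) l =
      D.side (D.step (D.overIn x) (!(l ^^ !D.pos x))) (a ^^ !D.pos x) := fun a l => by
    rw [Bool.xor_not, Bool.xor_not, Bool.not_not, side_step_underIn]
  have cy := D.side_step_overIn y
  have cy' : ∀ a l, D.side (D.step (D.underIn y) a) l =
      D.side (D.step (D.overIn y) (!(l ^^ !D.pos y))) (a ^^ !D.pos y) := fun a l => by
    rw [Bool.xor_not, Bool.xor_not, Bool.not_not, side_step_underIn]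
  have cz := D.side_step_overIn z
  rw [hxo, hxu] at cx cx'
  rw [hyo, hyu] at cy cy'
  rw [hzo, hzu] at cz
  have px : D.pos x = (p ^^ j) := D.sign_of_corner cx hΔt (hΔM _ (hfarm j))
  have px' : (!D.pos x) = (q ^^ i) := D.sign_of_corner cx' hΔm (hΔM _ (hfart i))
  have py : D.pos y = (p ^^ k) := D.sign_of_corner cy hΔt (hΔM _ (hfarb k))
  have pz : D.pos z = (!(p ^^ i ^^ j) ^^ !k) := by
    rw [px] at px'
    exact (D.sign_of_corner cz hΔm (hΔM _ (hfarb _))).trans (triangle_sign_bits p q i j k px')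
  -- the shadings of the two diagrams agree except on the triangle, which changes its colour
  let u : D.R → Bool := fun R => D'.shading (σ R)
  let f : D.E → Bool → Bool := fun e l => D'.shading (D'.side (ε e) l)
  have hf : ∀ e l, f e (!l) = !f e l := fun e l => D'.shading_isShading.side_not _ _
  have hfu : ∀ e ∉ M, ∀ l, f e l = u (D.side e l) := fun e he l => by
    have : e ≠ D.next t ∧ e ≠ D.next m ∧ e ≠ D.next b :=
      ⟨fun h => he (.inl h), fun h => he (.inr (.inl h)), fun h => he (.inr (.inr h))⟩
    simp only [f, u, hside e l this.1 this.2.1 this.2.2]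
  have ut : u (D.side (D.next t) (!p)) = u Δ := by
    rw [D.shade_away_from_triangle cx hΔt (hΔM _ (hfarm j)) u f hf (hfu _ (hfarm j))
      (hfu _ (hfart i)) fun l => ?_]
    · simp only [f, u, hΔt']
    · simp only [f, ← hnext, ← hyo', D'.shading_isShading.side_next_overIn]
  have um : u (D.side (D.next m) (!q)) = u Δ := by
    rw [D.shade_away_from_triangle cx' hΔm (hΔM _ (hfart i)) u f hf (hfu _ (hfart i))
      (hfu _ (hfarm j)) fun l => ?_]
    · simp only [f, u, hΔm']
    · simp only [f, ← hnext, ← hzo', D'.shading_isShading.side_next_overIn]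
  have ub : u (D.side (D.next b) (!r)) = u Δ := by
    rw [D.shade_away_from_triangle cy' hΔb (hΔM _ (hfart _)) u f hf (hfu _ (hfart _))
      (hfu _ (hfarb k)) fun l => ?_]
    · simp only [f, u, hΔb']
    · simp only [f, ← hnext, ← hzu', D'.shading_isShading.side_next_underIn]
  have hs : D.IsShading fun R => u R ^^ decide (R = Δ) := by
    have hu : ∀ R, R ≠ Δ → (u R ^^ decide (R = Δ)) = u R := fun R hR => by simp [hR]
    have hmid : ∀ e l, D.side e l = Δ → u (D.side e (!l)) = u Δ →
        (u (D.side e true) ^^ decide (D.side e true = Δ)) ≠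
          (u (D.side e false) ^^ decide (D.side e false = Δ)) := by
      intro e l h1 h2
      have h3 := D.shading_isShading.side_not e l
      have h4 : D.side e (!l) ≠ Δ := fun h => by simp [h, h1] at h3
      cases l
      · rw [Bool.not_false] at h2 h4; rw [hu _ h4, h1, h2]; simp
      · rw [Bool.not_true] at h2 h4; rw [hu _ h4, h1, h2]; simp
    refine ⟨?_, fun e => ?_⟩
    · refine (hu _ hout).trans ?_
      simp only [u, ← hout']; exact D'.shading_isShading.1
    · by_cases he : e ∈ M
      · rcases he with rfl | rfl | rfl
        exacts [hmid _ _ hΔt ut, hmid _ _ hΔm um, hmid _ _ hΔb ub]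
      · beta_reduce
        rw [hu _ (hΔM e he _), hu _ (hΔM e he _), ← hfu e he, ← hfu e he]
        exact D'.shading_isShading.2 _
  have hS := hs.eq_shading
  have hshade : ∀ e ∉ M, D'.leftShade (ε e) = D.leftShade e := fun e he => by
    have h1 := hΔM e he true
    unfold leftShade
    rw [← hS]
    simp only [h1, decide_false, Bool.xor_false]
    exact hfu e he true
  -- the signs of the three crossings
  have sxy : D.crossingSign y = -D.crossingSign x := D.crossingSign_consecutive_over hxo hyo
  have syz : D.crossingSign z = D.crossingSign x := by
    rw [D.crossingSign_consecutive_under hyu hzu, sxy, neg_neg]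
  have syy' : D'.crossingSign (κ y) = D.crossingSign x := by
    have hi := hshade _ (hfart i)
    cases i
    · rw [crossingSign_eq_overIn, crossingSign_eq_overIn, hyo', hxo]
      exact congrArg (fun v => -shadeSign v) hi
    · rw [crossingSign_eq_overOut, crossingSign_eq_overOut, hyo', hxo, hnext]
      exact congrArg shadeSign hi
  have hstep : ∀ e a, D'.step (ε e) a = ε (D.step e a) := by
    rintro e (_ | _)
    exacts [rfl, hnext e]
  have sxy' : D'.crossingSign (κ x) = -D.crossingSign x := by
    rw [D'.crossingSign_consecutive_over (hyo'.trans (hstep t i).symm)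
      (hxo'.trans (hstep t (!i)).symm), syy']
  have syz' : D'.crossingSign (κ z) = -D.crossingSign x := by
    rw [← syy', D'.crossingSign_consecutive_under (hzu'.trans (hstep b k).symm)
      (hyu'.trans (hstep b (!k)).symm), neg_neg]
  -- the six incoming edges are the heads of the local passages, in both diagrams
  let P : Set D.E := {t, D.next t, m, D.next m, b, D.next b}
  have hPt : ∀ a, D.step t a ∈ P := by rintro (_ | _) <;> simp [P]
  have hPm : ∀ a, D.step m a ∈ P := by rintro (_ | _) <;> simp [P]
  have hPb : ∀ a, D.step b a ∈ P := by rintro (_ | _) <;> simp [P]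
  have hP : ∀ e ∈ P, ∃ a, e = D.step t a ∨ e = D.step m a ∨ e = D.step b a := by
    rintro e (rfl | rfl | rfl | rfl | rfl | rfl)
    exacts [⟨false, .inl rfl⟩, ⟨true, .inl rfl⟩, ⟨false, .inr (.inl rfl)⟩,
      ⟨true, .inr (.inl rfl)⟩, ⟨false, .inr (.inr rfl)⟩, ⟨true, .inr (.inr rfl)⟩]
  have hPD : ∀ e ∈ P, ∃ c, (c = x ∨ c = y ∨ c = z) ∧ (D.overIn c = e ∨ D.underIn c = e) := by
    intro e he
    obtain ⟨a, rfl | rfl | rfl⟩ := hP e he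
    · obtain rfl | rfl := Bool.eq_or_eq_not a i
      exacts [⟨x, by simp, .inl hxo⟩, ⟨y, by simp, .inl hyo⟩]
    · obtain rfl | rfl := Bool.eq_or_eq_not a j
      exacts [⟨x, by simp, .inr hxu⟩, ⟨z, by simp, .inl hzo⟩]
    · obtain rfl | rfl := Bool.eq_or_eq_not a k
      exacts [⟨y, by simp, .inr hyu⟩, ⟨z, by simp, .inr hzu⟩]
  have hPD' : ∀ e ∈ P, ∃ c, D'.overIn c = ε e ∨ D'.underIn c = ε e := by
    intro e he
    obtain ⟨a, rfl | rfl | rfl⟩ := hP e he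
    · obtain rfl | rfl := Bool.eq_or_eq_not a i
      exacts [⟨κ y, .inl hyo'⟩, ⟨κ x, .inl hxo'⟩]
    · obtain rfl | rfl := Bool.eq_or_eq_not a j
      exacts [⟨κ z, .inl hzo'⟩, ⟨κ x, .inr hxu'⟩]
    · obtain rfl | rfl := Bool.eq_or_eq_not a k
      exacts [⟨κ z, .inr hzu'⟩, ⟨κ y, .inr hyu'⟩]
  have hA : ∀ c, c ≠ x → c ≠ y → c ≠ z → D.overIn c ∉ P ∧ D.underIn c ∉ P := by
    intro c hx hy hz
    constructor <;> intro h <;> obtain ⟨d, hd, hd' | hd'⟩ := hPD _ h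
    · obtain rfl := D.overIn_injective hd'; tauto
    · exact D.overIn_ne_underIn _ _ hd'.symm
    · exact D.overIn_ne_underIn _ _ hd'
    · obtain rfl := D.underIn_injective hd'; tauto
  have hMP : ∀ e ∉ P, D.next e ∉ M := by
    rintro e he (h | h | h)
    exacts [he (D.next.injective h ▸ hPt false), he (D.next.injective h ▸ hPm false),
      he (D.next.injective h ▸ hPb false)]
  -- the local colourings
  have hlocD : ∀ ρ : D.E → X, D.LocalColoring ![x, y, z] P ρ ↔
      (ρ (D.next t) = ρ (D.farEnd t i) ∧
        ρ (D.next m) = act p (ρ (D.farEnd m j)) (ρ (D.next t))) ∧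
      (ρ (D.next t) = ρ (D.farEnd t (!i)) ∧
        ρ (D.next b) = act p (ρ (D.farEnd b k)) (ρ (D.next t))) ∧
      (ρ (D.next m) = ρ (D.farEnd m (!j)) ∧
        ρ (D.next b) = act (!(p ^^ i ^^ j)) (ρ (D.farEnd b (!k))) (ρ (D.next m))) := by
    intro ρ
    have hj : ∀ e ∈ P, D.IsJoint e → ρ (D.next e) = ρ e := fun e he hj =>
      (not_isJoint_of_incoming (hPD e he).choose_spec.2 hj).elim
    refine (and_iff_right hj).trans ?_
    simp only [Fin.forall_fin_succ, IsEmpty.forall_iff, and_true]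
    exact and_congr (colorsAt_iff (ε := Equiv.refl _) (fun _ => rfl) hxo hxu px ρ)
      (and_congr (colorsAt_iff (ε := Equiv.refl _) (fun _ => rfl) hyo hyu py ρ)
        (colorsAt_iff (ε := Equiv.refl _) (fun _ => rfl) hzo hzu pz ρ))
  have px₂ : D'.pos (κ x) = (!p ^^ !j) := by rw [hpos, px]; simp
  have py₂ : D'.pos (κ y) = (!p ^^ !k) := by rw [hpos, py]; simp
  have pz₂ : D'.pos (κ z) = ((p ^^ i ^^ j) ^^ k) := by rw [hpos, pz]; simp
  have hlocD' : ∀ ρ : D.E → X, D'.LocalColoring (κ ∘ ![x, y, z]) (ε '' P) (ρ ∘ ε.symm) ↔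
      (ρ (D.next t) = ρ (D.farEnd t (!i)) ∧
        ρ (D.next m) = act (!p) (ρ (D.farEnd m (!j))) (ρ (D.next t))) ∧
      (ρ (D.next t) = ρ (D.farEnd t i) ∧
        ρ (D.next b) = act (!p) (ρ (D.farEnd b (!k))) (ρ (D.next t))) ∧
      (ρ (D.next m) = ρ (D.farEnd m j) ∧
        ρ (D.next b) = act (p ^^ i ^^ j) (ρ (D.farEnd b k)) (ρ (D.next m))) := by
    intro ρ
    have hj : ∀ e ∈ ε '' P, D'.IsJoint e → (ρ ∘ ε.symm) (D'.next e) = (ρ ∘ ε.symm) e := by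
      rintro _ ⟨e, he, rfl⟩ hj
      exact (not_isJoint_of_incoming (hPD' e he).choose_spec hj).elim
    refine (and_iff_right hj).trans ?_
    simp only [Fin.forall_fin_succ, IsEmpty.forall_iff, and_true]
    exact and_congr (colorsAt_iff hnext hxo' hxu' px₂ ρ)
      (and_congr (colorsAt_iff hnext hyo' hyu' py₂ ρ) (colorsAt_iff hnext hzo' hzu' pz₂ ρ))
  generalize (p ^^ i ^^ j) = w at *
  -- only these two edges are recoloured; the strand from `t` passes over at both crossings
  let S : Set D.E := {D.next m, D.next b}
  have hSM : ∀ e ∉ M, e ∉ S := fun e he h => he (.inr h)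
  have htS : D.next t ∉ S := by
    rintro (h | h)
    exacts [htm true true h, htb true true h]
  have hkey : ∀ (ρ : D.E → X) (v₁ v₂ : X), ∃ ρ' : D.E → X, (∀ e ∉ S, ρ' e = ρ e) ∧
      ρ' (D.next m) = v₁ ∧ ρ' (D.next b) = v₂ := fun ρ v₁ v₂ =>
    ⟨Function.update (Function.update ρ (D.next b) v₂) (D.next m) v₁, fun e he => by
      rw [Function.update_of_ne fun h => he (.inl h), Function.update_of_ne fun h => he (.inr h)],
      Function.update_self .., by
      rw [Function.update_of_ne (show D.next b ≠ D.next m from (hmb true true).symm),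
        Function.update_self]⟩
  let A := {c : D.C // c ≠ x ∧ c ≠ y ∧ c ≠ z}
  have hbij : Function.Bijective (Sum.elim Subtype.val ![x, y, z] : A ⊕ Fin 3 → D.C) := by
    refine ⟨Function.Injective.sumElim Subtype.val_injective ?_ ?_, fun c => ?_⟩
    · intro a c h
      fin_cases a <;> fin_cases c
      exacts [rfl, absurd h hxy, absurd h hxz, absurd h.symm hxy, rfl, absurd h hyz,
        absurd h.symm hxz, absurd h.symm hyz, rfl]
    · rintro ⟨c, hx, hy, hz⟩ a
      fin_cases a
      exacts [hx, hy, hz]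
    · by_cases hx : c = x
      · exact ⟨.inr 0, hx.symm⟩
      by_cases hy : c = y
      · exact ⟨.inr 1, hy.symm⟩
      by_cases hz : c = z
      · exact ⟨.inr 2, hz.symm⟩
      exact ⟨.inl ⟨c, hx, hy, hz⟩, rfl⟩
  have hc₀ : (fun a => Equiv.ofBijective _ hbij (.inr a)) = ![x, y, z] := rfl
  have hc₁ : (fun a => (Equiv.ofBijective _ hbij).trans κ (.inr a)) = κ ∘ ![x, y, z] := rfl
  refine stateSum_eq_of_local φ ε (A := A) (B := Fin 3) (B' := Fin 3)
    (Equiv.ofBijective _ hbij) ((Equiv.ofBijective _ hbij).trans κ) P S hnext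
    (fun ⟨c, hx, hy, hz⟩ => ⟨(hkeep c hx hy hz).1, (hkeep c hx hy hz).2, hpos c⟩)
    (fun ⟨c, hx, hy, hz⟩ => ?_) (fun a => ?_) (fun a => ?_)
    (fun ⟨c, hx, hy, hz⟩ => hA c hx hy hz) (fun e he => ⟨fun h => ?_, hSM _ (hMP e he)⟩)
    (fun ρ hl => ?_) (fun ρ' hl => ?_) (fun ρ₁ ρ₂ h h₁ h₂ => ?_) (fun ρ₁ ρ₂ h h₁ h₂ => ?_)
    (fun ρ ρ' h hl hl' => ?_)
  · show D'.crossingSign (κ c) = D.crossingSign c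
    rw [crossingSign_eq_overOut, crossingSign_eq_overOut, (hkeep c hx hy hz).1, hnext,
      hshade _ (hMP _ (hA c hx hy hz).1)]
  · fin_cases a
    · exact ⟨hxo ▸ hPt i, hxu ▸ hPm j⟩
    · exact ⟨hyo ▸ hPt _, hyu ▸ hPb k⟩
    · exact ⟨hzo ▸ hPm _, hzu ▸ hPb _⟩
  · have h : ∀ {e : D'.E} {e' : D.E}, e = ε e' → e' ∈ P → ε.symm e ∈ P := by
      rintro _ e' rfl he
      rwa [ε.symm_apply_apply]
    fin_cases a
    · exact ⟨h hxo' (hPt _), h hxu' (hPm _)⟩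
    · exact ⟨h hyo' (hPt _), h hyu' (hPb _)⟩
    · exact ⟨h hzo' (hPm _), h hzu' (hPb _)⟩
  · rcases h with rfl | rfl
    exacts [he (hPm true), he (hPb true)]
  · rw [hc₀, hlocD] at hl
    obtain ⟨⟨t₁, m₁⟩, ⟨t₂, b₁⟩, m₂, b₂⟩ := hl
    obtain ⟨ρ', h, hm, hb⟩ := hkey ρ (ρ (D.farEnd m j))
      (act w (ρ (D.farEnd b k)) (ρ (D.farEnd m j)))
    refine ⟨ρ', h, ?_⟩
    rw [hc₁, hlocD', hm, hb, h _ htS, h _ (hSM _ (hfart _)), h _ (hSM _ (hfart _)),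
      h _ (hSM _ (hfarm _)), h _ (hSM _ (hfarm _)), h _ (hSM _ (hfarb _)), h _ (hSM _ (hfarb _))]
    refine ⟨⟨t₂, eq_act_not.2 (m₂.symm.trans m₁)⟩, ⟨t₁, ?_⟩, rfl, rfl⟩
    rw [← act_triangle, ← b₁, ← m₁]
    exact b₂
  · rw [hc₁, hlocD'] at hl
    obtain ⟨⟨t₁, m₁⟩, ⟨t₂, b₁⟩, m₂, b₂⟩ := hl
    obtain ⟨ρ, h, hm, hb⟩ := hkey ρ' (ρ' (D.farEnd m (!j)))
      (act p (ρ' (D.farEnd b k)) (ρ' (D.next t)))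
    refine ⟨ρ, fun e he => (h e he).symm, ?_⟩
    rw [hc₀, hlocD, hm, hb, h _ htS, h _ (hSM _ (hfart _)), h _ (hSM _ (hfart _)),
      h _ (hSM _ (hfarm _)), h _ (hSM _ (hfarm _)), h _ (hSM _ (hfarb _)), h _ (hSM _ (hfarb _))]
    have h1 := eq_act_not.1 (m₂.symm.trans m₁)
    refine ⟨⟨t₂, h1⟩, ⟨t₁, rfl⟩, rfl, ?_⟩
    rw [h1, act_triangle, ← b₁, ← m₂]
    exact b₂.symm
  · rw [hc₀, hlocD] at h₁ h₂
    rintro e (rfl | rfl)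
    · rw [h₁.1.2, h₂.1.2, h _ htS, h _ (hSM _ (hfarm _))]
    · rw [h₁.2.1.2, h₂.2.1.2, h _ htS, h _ (hSM _ (hfarb _))]
  · rw [hc₁, hlocD'] at h₁ h₂
    rintro e (rfl | rfl)
    · rw [h₁.1.2, h₂.1.2, h _ htS, h _ (hSM _ (hfarm _))]
    · rw [h₁.2.1.2, h₂.2.1.2, h _ htS, h _ (hSM _ (hfarb _))]
  · rw [hc₀, hlocD] at hl
    rw [hc₁, hlocD'] at hl'
    obtain ⟨⟨t₁, m₁⟩, ⟨t₂, b₁⟩, m₂, b₂⟩ := hl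
    obtain ⟨⟨t₃, m₃⟩, ⟨t₄, b₃⟩, m₄, b₄⟩ := hl'
    have ex := exponentAt_eq φ (ε := Equiv.refl D.E) (fun _ => rfl) hxo hxu px t₁
    have ey := exponentAt_eq φ (ε := Equiv.refl D.E) (fun _ => rfl) hyo hyu py t₂
    have ez := exponentAt_eq φ (ε := Equiv.refl D.E) (fun _ => rfl) hzo hzu pz m₂
    have ex' := exponentAt_eq φ hnext hxo' hxu' px₂ t₃
    have ey' := exponentAt_eq φ hnext hyo' hyu' py₂ t₄
    have ez' := exponentAt_eq φ hnext hzo' hzu' pz₂ m₄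
    have key := hφ.triangle p w (t := ρ (D.next t)) (m := ρ (D.farEnd m j)) (m' := ρ (D.next m))
      (b := ρ (D.farEnd b k)) (b' := ρ (D.farEnd b (!k))) (B := ρ (D.next b))
      (B' := ρ' (D.next b)) m₁ b₁ b₂
      (by rw [b₃, h _ htS, h _ (hSM _ (hfarb _))])
      (by rw [b₄, m₄, h _ (hSM _ (hfarb _)), h _ (hSM _ (hfarm _))])
    rw [m₄, h _ htS, h _ (hSM _ (hfarm _)), h _ (hSM _ (hfarm _))] at ex'
    rw [h _ htS, h _ (hSM _ (hfarb _))] at ey'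
    rw [m₄, h _ (hSM _ (hfarb _)), h _ (hSM _ (hfarm _))] at ez'
    rw [← m₂] at ex'
    rw [Fin.sum_univ_three, Fin.sum_univ_three]
    refine (congrArg₂ _ (congrArg₂ _ ex ey) ez).trans
      (Eq.trans ?_ (congrArg₂ _ (congrArg₂ _ ex' ey') ez').symm)
    rw [sxy, syz, sxy', syy', syz', neg_smul, neg_smul, neg_smul, ← sub_eq_add_neg, ← smul_sub,
      ← smul_add, key, smul_neg, smul_add, smul_sub]
    abel

end MoveThree

end LinkDiagram

theorem theorem5p1 {X : Type*} [Quandle X] [Finite X] {G : Type*} [AddCommGroup G] :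
    (∀ φ : (Fin 2 → X) → G, PosQuandle.IsTwoCocycle φ →
      ∀ D D' : LinkDiagram, D.ReidemeisterEquiv D' → D.stateSum φ = D'.stateSum φ) ∧
    (∀ φ₁ φ₂ : (Fin 2 → X) → G, PosQuandle.IsTwoCocycle φ₁ → PosQuandle.IsTwoCocycle φ₂ →
      PosQuandle.IsTwoCoboundary (φ₁ - φ₂) →
      ∀ D : LinkDiagram, D.stateSum φ₁ = D.stateSum φ₂) ∧
    (∀ φ : (Fin 2 → X) → G, PosQuandle.IsTwoCoboundary φ →
      ∀ D : LinkDiagram, D.stateSum φ = ∑ _ρ : D.Coloring X, 1) := by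
  refine ⟨fun φ hφ D D' h => ?_, fun φ₁ φ₂ _ _ h D => D.stateSum_eq_of_sub_coboundary h,
    fun φ h D => ?_⟩
  · induction h with
    | rel D D' h =>
      rcases h with h | h | h | h | h
      exacts [h.stateSum_eq φ, h.stateSum_eq φ, h.stateSum_eq hφ, h.stateSum_eq φ,
        h.stateSum_eq hφ]
    | refl D => rfl
    | symm D D' _ ih => exact ih.symm
    | trans D D' D'' _ _ ih ih' => exact ih.trans ih'
  · rw [← D.stateSum_zero (X := X) (G := G)]
    exact D.stateSum_eq_of_sub_coboundary (by rwa [sub_zero])
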